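/- Let $p,q\in\mathbb{C}$ with $|p|<1$ and $q\neq 0$. For $x\neq 0$ put $(x;p)_\infty=\prod_{k\ge 0}(1-xp^k)$ and $E(x)=E(x;p)=(x;p)_\infty\,(p/x;p)_\infty$. For a base $b\in\{q,q^2\}$, $a\neq0$ and $m\in\mathbb{Z}$ define the elliptic shifted factorial $$(a;b,p)_m=\begin{cases}\prod_{k=0}^{m-1}E(ab^k) & m>0,\\ 1 & m=0,\\ 1/\prod_{k=0}^{-m-1}E(ab^{m+k})=1/(ab^m;b,p)_{-m} & m<0,\end{cases}$$ and write $(a_1,\dots,a_r;b,p)_m=(a_1;b,p)_m\cdots(a_r;b,p)_m$. For $m<0$ a factor $1/(a;b,p)_m$ is read as the finite product $(ab^m;b,p)_{-m}$, also when this product vanishes. Theorem. Let $n$ be a positive integer and let $x,y\in\mathbb{C}\setminus\{0\}$ be such that none of the denominators below vanishes, that is: for $1\le j<i\le n$ the denominator of the $(i,j)$ entry of the matrix is nonzero; for $1\le i<j\le n$ the three factors $(aq^{2(i-j)};q^2,p)_{j-i}$ with $a\in\{yq^{1-i}/x,\;q^{2-i}/xy,\;q^{2-4i}/x^2\}$ are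 nonzero; and for $1\le i\le n$ the denominators on the right-hand side are nonzero. Then $$\det_{1\le i,j\le n}\left(\frac{(yq^{1-i}/x,\;q^{2-i}/xy,\;q^{2-4i}/x^2;\,q^2,p)_{i-j}}{(q^{2-2i}/xy,\;yq^{1-2i}/x,\;q^{i+1};\,q,p)_{i-j}}\right)=\prod_{i=1}^n\frac{(q,\;x^2q^{2i-2};\,q,p)_i}{(q,\;x^2q^{2i-2};\,q^2,p)_i}\cdot\frac{(xyq^{i-1},\;xq^i/y;\,q^2,p)_i}{(xyq^{i-1},\;xq^i/y;\,q,p)_i}.$$ -/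

import Mathlib

noncomputable section

namespace EllipticDet

/-- The infinite `q`-shifted factorial `(x; p)_∞ = ∏_{k ≥ 0} (1 - x p^k)`, for `|p| < 1`. -/
def infPoch (x p : ℂ) : ℂ := ∏' k : ℕ, (1 - x * p ^ k)

/-- The theta function `E(x; p) = (x; p)_∞ (p / x; p)_∞`, for `|p| < 1` and `x ≠ 0`. -/
def E (x p : ℂ) : ℂ := infPoch x p * infPoch (p / x) p

/-- The elliptic shifted factorial `(a; q, p)_n` for an integer `n`. -/
def ellPoch (a q p : ℂ) (n : ℤ) : ℂ :=
  if 0 ≤ n then ∏ k ∈ Finset.range n.toNat, E (a * q ^ k) p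
  else 1 / ∏ k ∈ Finset.range (-n).toNat, E (a * q ^ (n + (k : ℤ))) p

/-- The condensed notation `(a₁, …, aₘ; q, p)_n = (a₁; q, p)_n ⋯ (aₘ; q, p)_n`. -/
def ellPochs (as : List ℂ) (q p : ℂ) (n : ℤ) : ℂ := (as.map fun a => ellPoch a q p n).prod

/-- The `(i, j)` entry of the matrix (rows and columns are numbered from `1`).
For `i < j` the subscript `i - j` is negative, so that `1 / (q^(i+1); q, p)_(i-j)` stands for the
finite product `(q^(2i-j+1); q, p)_(j-i)`, which is `0` as soon as `2i - j + 1 ≤ 0`. The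
convention `1 / 0 = 0` of division returns exactly this product in all cases, since
`1 / (1 / P) = P` also for `P = 0`. -/
def entry (x y q p : ℂ) (i j : ℤ) : ℂ :=
  ellPochs [y * q ^ (1 - i) / x, q ^ (2 - i) / (x * y), q ^ (2 - 4 * i) / x ^ 2] (q ^ 2) p (i - j) /
    ellPochs [q ^ (2 - 2 * i) / (x * y), y * q ^ (1 - 2 * i) / x, q ^ (i + 1)] q p (i - j)

/-- No denominator vanishes in the entries of the `n × n` matrix: for `i > j` these are the
displayed denominators, and for `i < j` they come from `(a; q^2, p)_(i-j)
= 1 / (a q^(2(i-j)); q^2, p)_(j-i)`. -/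
def EntriesDefined (n : ℕ) (x y q p : ℂ) : Prop :=
  (∀ i j : ℤ, 1 ≤ j → j < i → i ≤ n →
    ellPochs [q ^ (2 - 2 * i) / (x * y), y * q ^ (1 - 2 * i) / x, q ^ (i + 1)] q p (i - j) ≠ 0) ∧
  (∀ i j : ℤ, 1 ≤ i → i < j → j ≤ n →
    ellPochs [y * q ^ (1 - i) / x * q ^ (2 * (i - j)), q ^ (2 - i) / (x * y) * q ^ (2 * (i - j)),
      q ^ (2 - 4 * i) / x ^ 2 * q ^ (2 * (i - j))] (q ^ 2) p (j - i) ≠ 0)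

/-- No denominator vanishes in the product side of the determinant evaluation. -/
def ProductDefined (n : ℕ) (x y q p : ℂ) : Prop :=
  ∀ i : ℤ, 1 ≤ i → i ≤ n →
    ellPochs [q, x ^ 2 * q ^ (2 * i - 2)] (q ^ 2) p i ≠ 0 ∧
    ellPochs [x * y * q ^ (i - 1), x * q ^ i / y] q p i ≠ 0

end EllipticDet

end

open Filter Topology
namespace EllipticDet

/-! ### The infinite product and the zeros of `E`. -/

section InfiniteProduct

variable {p : ℂ}

/-! For generic q, x, y the matrix M has an explicit triangular factorization. Moving one column to
the right multiplies an entry by a quotient of theta functions (`entry_succ_right`). Hence, up to a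
factor of the row and a factor of the column, the entry (i, j) is the part `paramPart` with m = j -
1 of the summand of a terminating quadratic series, whose parameters A, B and C = q^(-(2i-1)) depend
on the row. Let the j-th column of an upper triangular matrix V hold the other part of the summand,
`terminatingPart`, divided by the column factor. Then each entry of M V is a row factor times a full
sum, which `sum_eq_quadValue` evaluates in closed form. This value contains (Cq; q^2, p)_(j-1), and
for i < j one of its factors is E(1) = 0. So M V is lower triangular, its diagonal entries are those
of V times the factors of the claimed product (`quadValue_eq`), and taking determinants gives the
formula.

The quadratic sum S_N is found by induction: S_(N+1) = R S_N with R a quotient of theta functions.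
The difference of the two sides telescopes (`partial_sum`), and the one extra summand of S_(N+1)
cancels the boundary term (`last_summand`). Each telescoping step is `step_identity`, a combination
of four instances of the three-term relation.

The three-term relation comes from the Laurent expansion of `E`, whose coefficients are Gaussian in
the index (`thetaCoeff_eq`). Sorting the double series of a product by parity writes z E(xz) E(x/z)
as a 2 × 2 determinant in x and z (`E_mul_E_eq_bracket`), and the relation is then the Plücker
identity.

Finally, generic parameters are dense, and both sides are continuous wherever the stated
denominators do not vanish. -/

lemma summable_norm_mul_geometric (hp : ‖p‖ < 1) (x : ℂ) : Summable fun k : ℕ => ‖-(x * p ^ k)‖ := by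
  simp only [norm_neg, norm_mul, norm_pow]
  exact (summable_geometric_of_lt_one (norm_nonneg _) hp).mul_left _

lemma multipliable_infPoch (hp : ‖p‖ < 1) (x : ℂ) : Multipliable fun k : ℕ => 1 - x * p ^ k := by
  simpa [sub_eq_add_neg] using multipliable_one_add_of_summable (summable_norm_mul_geometric hp x)

lemma infPoch_eq_mul (hp : ‖p‖ < 1) (x : ℂ) : infPoch x p = (1 - x) * infPoch (p * x) p := by
  have h := multipliable_infPoch hp (p * x)
  have e : (fun k : ℕ => 1 - p * x * p ^ k) = fun k => 1 - x * p ^ (k + 1) := by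
    funext k; ring
  unfold infPoch
  rw [e] at h ⊢
  simpa using tprod_eq_zero_mul' (f := fun k : ℕ => 1 - x * p ^ k) h

lemma infPoch_ne_zero (hp : ‖p‖ < 1) {x : ℂ} (h : ∀ k : ℕ, x * p ^ k ≠ 1) : infPoch x p ≠ 0 := by
  have := tprod_one_add_ne_zero_of_summable (f := fun k : ℕ => -(x * p ^ k))
    (fun k => by simpa [← sub_eq_add_neg, sub_eq_zero] using (h k).symm)
    (summable_norm_mul_geometric hp x)
  simpa [infPoch, sub_eq_add_neg] using this

lemma continuous_infPoch (hp : ‖p‖ < 1) : Continuous fun x => infPoch x p := by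
  have key : HasProdLocallyUniformlyOn (fun (k : ℕ) (x : ℂ) => 1 + -(x * p ^ k))
      (fun x => ∏' k : ℕ, (1 + -(x * p ^ k))) Set.univ := by
    refine hasProdLocallyUniformlyOn_of_forall_compact isOpen_univ fun K _ hK => ?_
    obtain ⟨C, hC⟩ := hK.isBounded.exists_norm_le
    refine ((summable_geometric_of_lt_one (norm_nonneg _) hp).mul_left C).hasProdUniformlyOn_nat_one_add
      hK (.of_forall fun n x hx => ?_) (fun _ => by fun_prop)
    rw [norm_neg, norm_mul, norm_pow]
    gcongr
    exact hC x hx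
  rw [← continuousOn_univ]
  have := key.continuousOn (.of_forall fun s => by fun_prop)
  simpa [infPoch, sub_eq_add_neg] using this

lemma E_inv (hp : ‖p‖ < 1) {x : ℂ} (hx : x ≠ 0) : E x⁻¹ p = -E x p / x := by
  simp only [E]
  rw [infPoch_eq_mul hp x, infPoch_eq_mul hp x⁻¹, div_inv_eq_mul, ← div_eq_mul_inv]
  field_simp
  ring

lemma continuousAt_E (hp : ‖p‖ < 1) {x : ℂ} (hx : x ≠ 0) : ContinuousAt (fun x => E x p) x := by
  have h := continuous_infPoch hp
  refine h.continuousAt.mul ?_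
  exact ContinuousAt.comp (g := fun x => infPoch x p) h.continuousAt (by fun_prop (disch := assumption))

/-- Countability is all that is needed of the zeros: it shows that `E` is not identically zero and
that generic parameters are dense. The point 0 is added only so that p / x may be cleared. -/
lemma countable_zeros_E (hp : ‖p‖ < 1) : {x : ℂ | E x p = 0}.Countable := by
  refine (((Set.countable_range fun k : ℕ => (p ^ k)⁻¹).union
    (Set.countable_range fun k : ℕ => p ^ (k + 1))).union (Set.countable_singleton 0)).mono ?_
  intro x hx
  by_contra hn
  simp only [Set.mem_union, Set.mem_range, Set.mem_singleton_iff, not_or, not_exists] at hn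
  obtain ⟨⟨h1, h2⟩, h0⟩ := hn
  refine mul_ne_zero (infPoch_ne_zero hp fun k hk => ?_) (infPoch_ne_zero hp fun k hk => ?_) hx
  · exact h1 k (eq_inv_of_mul_eq_one_left hk).symm
  · refine h2 k ?_
    field_simp at hk
    rw [pow_succ', hk]

end InfiniteProduct

/-! ### Euler's power series for the infinite shifted factorial. -/

section Euler

variable {p : ℂ}

/-- The coefficients of the expansion `(x; p)_∞ = ∑ aₙ xⁿ`. -/
noncomputable def eulerCoeff (p : ℂ) (n : ℕ) : ℂ := ∏ k ∈ Finset.range n, (-p ^ k / (1 - p ^ (k + 1)))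

lemma one_sub_pow_ne_zero (hp : ‖p‖ < 1) (k : ℕ) : 1 - p ^ (k + 1) ≠ 0 := by
  rw [sub_ne_zero]
  intro h
  have := congrArg norm h
  rw [norm_pow, norm_one] at this
  exact absurd this.symm (pow_lt_one₀ (norm_nonneg _) hp (Nat.succ_ne_zero k)).ne

/-- This is the functional equation f(x) = (1 - x) f(px), read off coefficientwise. -/
lemma eulerCoeff_succ (hp : ‖p‖ < 1) (n : ℕ) :
    eulerCoeff p (n + 1) = p ^ (n + 1) * eulerCoeff p (n + 1) - p ^ n * eulerCoeff p n := by
  have := one_sub_pow_ne_zero hp n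
  rw [eulerCoeff, Finset.prod_range_succ, ← eulerCoeff]
  field_simp
  ring

lemma eulerCoeff_ne_zero (hp : ‖p‖ < 1) (h0 : p ≠ 0) (n : ℕ) : eulerCoeff p n ≠ 0 :=
  Finset.prod_ne_zero_iff.2 fun k _ =>
    div_ne_zero (neg_ne_zero.2 (pow_ne_zero _ h0)) (one_sub_pow_ne_zero hp k)

lemma summable_eulerCoeff (hp : ‖p‖ < 1) (h0 : p ≠ 0) (x : ℂ) :
    Summable fun n => ‖eulerCoeff p n * x ^ n‖ := by
  rcases eq_or_ne x 0 with rfl | hx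
  · refine summable_of_ne_finset_zero (s := {0}) fun n hn => ?_
    simp only [Finset.mem_singleton] at hn
    simp [hn]
  refine (summable_of_ratio_test_tendsto_lt_one (l := 0) one_pos
    (.of_forall fun n => mul_ne_zero (eulerCoeff_ne_zero hp h0 n) (pow_ne_zero n hx)) ?_).norm
  have h1 : Tendsto (fun n : ℕ => p ^ n) atTop (𝓝 0) := tendsto_pow_atTop_nhds_zero_of_norm_lt_one hp
  have h2 : Tendsto (fun n : ℕ => ‖-p ^ n / (1 - p ^ (n + 1)) * x‖) atTop (𝓝 ‖-0 / (1 - 0) * x‖) :=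
    ((h1.neg.div (tendsto_const_nhds.sub ((tendsto_add_atTop_iff_nat 1).2 h1)) (by simp)).mul_const
      x).norm
  simp only [neg_zero, zero_div, zero_mul, norm_zero] at h2
  refine h2.congr fun n => ?_
  rw [← norm_div]
  congr 1
  have := eulerCoeff_ne_zero hp h0 n
  have h3 : eulerCoeff p (n + 1) = eulerCoeff p n * (-p ^ n / (1 - p ^ (n + 1))) :=
    Finset.prod_range_succ _ _
  rw [h3, pow_succ x n]
  field_simp

/-- Euler's expansion of the infinite shifted factorial. -/
lemma hasSum_infPoch (hp : ‖p‖ < 1) (h0 : p ≠ 0) (x : ℂ) :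
    HasSum (fun n => eulerCoeff p n * x ^ n) (infPoch x p) := by
  set g : ℂ → ℂ := fun x => ∑' n, eulerCoeff p n * x ^ n with hg
  have hs : ∀ x, Summable fun n => eulerCoeff p n * x ^ n := fun x => (summable_eulerCoeff hp h0 x).of_norm
  have hfun : ∀ x, g x = (1 - x) * g (p * x) := by
    intro x
    have h1 := (hs (p * x)).tsum_eq_zero_add
    have h2 := (hs x).tsum_eq_zero_add
    have h3 := ((summable_nat_add_iff 1).2 (hs (p * x))).tsum_sub ((hs (p * x)).mul_left x)
    rw [tsum_mul_left] at h3
    have h4 : ∀ n, eulerCoeff p (n + 1) * (p * x) ^ (n + 1) - x * (eulerCoeff p n * (p * x) ^ n)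
        = eulerCoeff p (n + 1) * x ^ (n + 1) := by
      intro n
      have := eulerCoeff_succ hp n
      calc _ = (p ^ (n + 1) * eulerCoeff p (n + 1) - p ^ n * eulerCoeff p n) * x ^ (n + 1) := by ring
        _ = _ := by rw [← this]
    simp only [h4] at h3
    simp only [hg]
    rw [h2, h3, sub_mul, one_mul]
    nth_rw 2 [h1]
    simp
    ring
  -- Iterating the functional equation splits off the partial products; the remaining factor g(p^n
  -- x) tends to g(0) = 1 by dominated convergence.
  have hiter : ∀ n : ℕ, g x = (∏ k ∈ Finset.range n, (1 - x * p ^ k)) * g (p ^ n * x) := by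
    intro n
    induction n with
    | zero => simp
    | succ n ih =>
      rw [ih, hfun (p ^ n * x), Finset.prod_range_succ, pow_succ' p n]
      ring_nf
  have hlim : Tendsto (fun n : ℕ => g (p ^ n * x)) atTop (𝓝 1) := by
    have h1 : ∑' n, eulerCoeff p n * (0 : ℂ) ^ n = 1 := by
      rw [tsum_eq_single 0 (fun n hn => by simp [hn])]
      simp [eulerCoeff]
    rw [← h1]
    refine tendsto_tsum_of_dominated_convergence (summable_eulerCoeff hp h0 x) (fun k => ?_)
      (.of_forall fun n k => ?_)
    · have h2 : Tendsto (fun n : ℕ => p ^ n * x) atTop (𝓝 0) := by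
        simpa using (tendsto_pow_atTop_nhds_zero_of_norm_lt_one hp).mul_const x
      exact (h2.pow k).const_mul _
    · rw [norm_mul, norm_mul, norm_pow, norm_pow, norm_mul, norm_pow]
      gcongr
      exact mul_le_of_le_one_left (norm_nonneg _) (pow_le_one₀ (norm_nonneg _) hp.le)
  have hfin : g x = infPoch x p := by
    have h1 := (multipliable_infPoch hp x).tendsto_prod_tprod_nat.mul hlim
    rw [mul_one] at h1
    exact tendsto_nhds_unique (tendsto_const_nhds.congr hiter) h1
  rw [← hfin]
  exact (hs x).hasSum

end Euler

/-! ### Laurent expansion of the theta function. -/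

section Laurent

variable {p : ℂ}

lemma hasSum_mul_prod {f g : ℤ → ℂ} {a b : ℂ} (hf : HasSum f a) (hg : HasSum g b) :
    HasSum (fun c : ℤ × ℤ => f c.1 * g c.2) (a * b) :=
  hf.mul hg (summable_mul_of_summable_norm hf.summable.norm hg.summable.norm)

/-- The change of variables `(k, n) ↦ (n + k, n)`. -/
def shearEquiv : ℤ × ℤ ≃ ℤ × ℤ where
  toFun c := (c.2 + c.1, c.2)
  invFun c := (c.1 - c.2, c.2)
  left_inv c := by simp
  right_inv c := by simp

/-- The coefficients of Euler's expansion, extended by zero to the integers. -/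
noncomputable def eulerCoeffInt (p : ℂ) (k : ℤ) : ℂ := if 0 ≤ k then eulerCoeff p k.toNat else 0

lemma eulerCoeffInt_eq (hp : ‖p‖ < 1) (k : ℤ) :
    eulerCoeffInt p k = p ^ k * eulerCoeffInt p k - p ^ (k - 1) * eulerCoeffInt p (k - 1) := by
  rcases lt_trichotomy k 0 with hk | rfl | hk
  · simp [eulerCoeffInt, hk.not_ge, show ¬ (1 ≤ k) by omega]
  · simp [eulerCoeffInt]
  · obtain ⟨n, rfl⟩ : ∃ n : ℕ, k = n + 1 := ⟨(k - 1).toNat, by omega⟩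
    have h := eulerCoeff_succ hp n
    have e : ((n : ℤ) + 1).toNat = n + 1 := by omega
    simp only [eulerCoeffInt, add_sub_cancel_right, e, Int.toNat_natCast, Nat.cast_nonneg, if_true,
      if_pos hk.le]
    exact_mod_cast h

lemma hasSum_eulerCoeffInt (hp : ‖p‖ < 1) (h0 : p ≠ 0) (x : ℂ) :
    HasSum (fun k : ℤ => eulerCoeffInt p k * x ^ k) (infPoch x p) := by
  have hinj : Function.Injective (fun n : ℕ => (n : ℤ)) := Nat.cast_injective
  refine (hinj.hasSum_iff fun k hk => ?_).1 ?_
  · have : ¬ 0 ≤ k := fun h => hk ⟨k.toNat, by simpa using h⟩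
    simp [eulerCoeffInt, this]
  · simpa [Function.comp_def, eulerCoeffInt] using hasSum_infPoch hp h0 x

lemma hasSum_eulerCoeffInt_inv (hp : ‖p‖ < 1) (h0 : p ≠ 0) (x : ℂ) :
    HasSum (fun k : ℤ => p ^ k * eulerCoeffInt p k * x ^ (-k)) (infPoch (p / x) p) := by
  convert hasSum_eulerCoeffInt hp h0 (p / x) using 2 with k
  rw [div_zpow, zpow_neg]
  ring

/-- The Laurent coefficients of `E`. -/
noncomputable def thetaCoeff (p : ℂ) (k : ℤ) : ℂ :=
  ∑' n : ℤ, eulerCoeffInt p (n + k) * (p ^ n * eulerCoeffInt p n)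

/-- Multiply the Euler series in x and in p/x; the shear makes the first index the exponent of x. -/
lemma hasSum_E_double (hp : ‖p‖ < 1) (h0 : p ≠ 0) {x : ℂ} (hx : x ≠ 0) :
    HasSum (fun c : ℤ × ℤ => eulerCoeffInt p (c.2 + c.1) * (p ^ c.2 * eulerCoeffInt p c.2) * x ^ c.1)
      (E x p) := by
  have h1 := shearEquiv.hasSum_iff.2
    (hasSum_mul_prod (hasSum_eulerCoeffInt hp h0 x) (hasSum_eulerCoeffInt_inv hp h0 x))
  refine h1.congr_fun fun c => ?_
  have : x ^ c.2 ≠ 0 := zpow_ne_zero _ hx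
  simp only [shearEquiv, Function.comp, Equiv.coe_fn_mk, zpow_add₀ hx, zpow_neg]
  field_simp

lemma hasSum_thetaCoeff_apply (hp : ‖p‖ < 1) (h0 : p ≠ 0) (k : ℤ) :
    HasSum (fun n : ℤ => eulerCoeffInt p (n + k) * (p ^ n * eulerCoeffInt p n)) (thetaCoeff p k) := by
  have h : Summable fun n : ℤ => eulerCoeffInt p (n + k) * (p ^ n * eulerCoeffInt p n) := by
    simpa only [one_zpow, mul_one] using (hasSum_E_double hp h0 one_ne_zero).summable.prod_factor k
  exact h.hasSum

/-- The Laurent expansion of `E`. -/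
lemma hasSum_E (hp : ‖p‖ < 1) (h0 : p ≠ 0) {x : ℂ} (hx : x ≠ 0) :
    HasSum (fun k : ℤ => thetaCoeff p k * x ^ k) (E x p) := by
  refine HasSum.prod_fiberwise (hasSum_E_double hp h0 hx) fun k => ?_
  exact (hasSum_thetaCoeff_apply hp h0 k).mul_right (x ^ k)

/-- With U n = p^n a_n, Euler's recursion reads a_n = U n - U (n-1). The series for p^k c_k +
c_(k+1) then becomes the difference of the series of U(n+k+1) U(n) and its own shift, which is zero.
No uniqueness of Laurent expansions is needed. -/
lemma thetaCoeff_succ (hp : ‖p‖ < 1) (h0 : p ≠ 0) (k : ℤ) :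
    thetaCoeff p (k + 1) = -p ^ k * thetaCoeff p k := by
  set U : ℤ → ℂ := fun n => p ^ n * eulerCoeffInt p n with hU
  have hA : ∀ n, eulerCoeffInt p n = U n - U (n - 1) := eulerCoeffInt_eq hp
  have h1 := (hasSum_thetaCoeff_apply hp h0 k).mul_left (p ^ k)
  have h2 := hasSum_thetaCoeff_apply hp h0 (k + 1)
  have h3 : Summable fun n => U (n + (k + 1)) * U n := by
    have h := hasSum_eulerCoeffInt_inv hp h0 1
    simp only [one_zpow, mul_one] at h
    exact (hasSum_mul_prod h h).summable.comp_injective (i := fun n : ℤ => (n + (k + 1), n)) fun a b hab => by simpa using hab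
  have h4 := h3.hasSum.sub ((Equiv.subRight (1 : ℤ)).hasSum_iff.2 h3.hasSum)
  rw [sub_self] at h4
  have h5 := h1.add h2
  have h6 : (fun n => p ^ k * (eulerCoeffInt p (n + k) * (p ^ n * eulerCoeffInt p n)) +
      eulerCoeffInt p (n + (k + 1)) * (p ^ n * eulerCoeffInt p n)) =
      fun n => U (n + (k + 1)) * U n -
        ((fun n => U (n + (k + 1)) * U n) ∘ (Equiv.subRight (1 : ℤ))) n := by
    funext n
    have e1 : p ^ k * (eulerCoeffInt p (n + k) * (p ^ n * eulerCoeffInt p n))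
        = U (n + k) * eulerCoeffInt p n := by
      simp only [hU, zpow_add₀ h0]; ring
    rw [e1, hA n, hA (n + (k + 1))]
    simp only [Function.comp, Equiv.subRight_apply]
    rw [show p ^ n * (U n - U (n - 1)) = U n by rw [← hA n],
      show n + (k + 1) - 1 = n + k by ring, show n - 1 + (k + 1) = n + k by ring]
    ring
  rw [h6] at h5
  linear_combination h5.unique h4

/-- The triangular number `k (k - 1) / 2`. -/
def triangular (k : ℤ) : ℤ := k * (k - 1) / 2

lemma two_mul_triangular (k : ℤ) : 2 * triangular k = k * (k - 1) :=
  Int.mul_ediv_cancel' (Int.even_mul_pred_self k).two_dvd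

lemma triangular_succ (k : ℤ) : triangular (k + 1) = triangular k + k := by
  linarith [two_mul_triangular k, two_mul_triangular (k + 1)]

/-- Jacobi's triple product up to its constant. The value of the constant plays no role, only that
it is nonzero. -/
lemma thetaCoeff_eq (hp : ‖p‖ < 1) (h0 : p ≠ 0) (k : ℤ) :
    thetaCoeff p k = thetaCoeff p 0 * (-1) ^ k * p ^ triangular k := by
  have hone : (-1 : ℂ) ≠ 0 := by norm_num
  have step : ∀ k : ℤ, (-1 : ℂ) ^ (k + 1) * p ^ triangular (k + 1) =
      -p ^ k * ((-1) ^ k * p ^ triangular k) := fun k => by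
    rw [triangular_succ, zpow_add₀ h0, zpow_add_one₀ hone]; ring
  induction k using Int.induction_on with
  | zero => simp [triangular]
  | succ k ih => rw [thetaCoeff_succ hp h0, ih, mul_assoc _ _ (p ^ triangular (_ + 1)), step]; ring
  | pred k ih =>
    have h1 := thetaCoeff_succ hp h0 (-(k : ℤ) - 1)
    have h2 := step (-(k : ℤ) - 1)
    rw [sub_add_cancel] at h1 h2
    rw [h1, mul_assoc, h2] at ih
    have h3 : -p ^ (-(k : ℤ) - 1) ≠ 0 := neg_ne_zero.2 (zpow_ne_zero _ h0)
    apply mul_left_cancel₀ h3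
    rw [ih]; ring

end Laurent

/-! ### The Weierstrass three-term relation. -/

section Weierstrass

variable {p : ℂ}

/-- The first of two functions whose Wronskian-like bracket is `E (x z) E (x / z)`. -/
noncomputable def evenTheta (p x : ℂ) : ℂ := ∑' u : ℤ, p ^ (u * (u - 1)) * x ^ (2 * u)

/-- The second of two functions whose Wronskian-like bracket is `E (x z) E (x / z)`. -/
noncomputable def oddTheta (p x : ℂ) : ℂ := ∑' u : ℤ, p ^ (u ^ 2) * x ^ (2 * u + 1)

/-- Pairs of integers, sorted by the parity of their sum. -/
def parityEquiv : (ℤ × ℤ) ⊕ (ℤ × ℤ) ≃ ℤ × ℤ where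
  toFun := Sum.elim (fun c => (c.1 + c.2, c.1 - c.2)) (fun c => (c.1 + c.2 + 1, c.1 - c.2))
  invFun c := if (c.1 + c.2) % 2 = 0 then Sum.inl ((c.1 + c.2) / 2, (c.1 - c.2) / 2)
    else Sum.inr ((c.1 + c.2 - 1) / 2, (c.1 - c.2 - 1) / 2)
  left_inv := by
    rintro (⟨u, w⟩ | ⟨u, w⟩)
    · have : (u + w + (u - w)) % 2 = 0 := by omega
      simp only [Sum.elim_inl, this, if_true, Sum.inl.injEq, Prod.mk.injEq]
      omega
    · have : (u + w + 1 + (u - w)) % 2 ≠ 0 := by omega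
      simp only [Sum.elim_inr, this, if_false, Sum.inr.injEq, Prod.mk.injEq]
      omega
  right_inv := by
    rintro ⟨k, l⟩
    by_cases h : (k + l) % 2 = 0
    · simp only [h, if_true, Sum.elim_inl, Prod.mk.injEq]
      omega
    · simp only [h, if_false, Sum.elim_inr, Prod.mk.injEq]
      omega

/-- Otherwise every Laurent coefficient would vanish, and `E` would be zero at every nonzero point,
against the countability of its zeros. -/
lemma thetaCoeff_zero_ne_zero (hp : ‖p‖ < 1) (h0 : p ≠ 0) : thetaCoeff p 0 ≠ 0 := by
  intro h
  have hc : ({x : ℂ | E x p = 0} ∪ {0}).Countable :=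
    (countable_zeros_E hp).union (Set.countable_singleton 0)
  obtain ⟨x, hx⟩ := (hc.dense_compl ℂ).nonempty
  simp only [Set.mem_compl_iff, Set.mem_union, Set.mem_ofPred_eq, Set.mem_singleton_iff, not_or] at hx
  refine hx.1 ((hasSum_E hp h0 hx.2).unique ?_)
  have e : (fun k : ℤ => thetaCoeff p k * x ^ k) = fun _ => 0 := by
    funext k
    rw [thetaCoeff_eq hp h0, h]
    ring
  rw [e]
  exact hasSum_zero

lemma thetaCoeff_mul_even (hp : ‖p‖ < 1) (h0 : p ≠ 0) (u w : ℤ) :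
    thetaCoeff p (u + w) * thetaCoeff p (u - w) =
      thetaCoeff p 0 ^ 2 * (p ^ (u * (u - 1)) * p ^ (w ^ 2)) := by
  rw [thetaCoeff_eq hp h0 (u + w), thetaCoeff_eq hp h0 (u - w)]
  have e : triangular (u + w) + triangular (u - w) = u * (u - 1) + w ^ 2 := by
    linarith [two_mul_triangular (u + w), two_mul_triangular (u - w)]
  have s : (-1 : ℂ) ^ (u + w) * (-1) ^ (u - w) = 1 := by
    rw [← zpow_add₀ (by norm_num), show u + w + (u - w) = 2 * u by ring, zpow_mul]
    norm_num
  rw [← zpow_add₀ h0, ← e, zpow_add₀ h0]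
  linear_combination thetaCoeff p 0 ^ 2 * p ^ triangular (u + w) * p ^ triangular (u - w) * s

lemma thetaCoeff_mul_odd (hp : ‖p‖ < 1) (h0 : p ≠ 0) (u w : ℤ) :
    thetaCoeff p (u + w + 1) * thetaCoeff p (u - w) =
      -thetaCoeff p 0 ^ 2 * (p ^ (u ^ 2) * p ^ ((w + 1) * (w + 1 - 1))) := by
  rw [thetaCoeff_eq hp h0 (u + w + 1), thetaCoeff_eq hp h0 (u - w)]
  have e : triangular (u + w + 1) + triangular (u - w) = u ^ 2 + (w + 1) * (w + 1 - 1) := by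
    linarith [two_mul_triangular (u + w + 1), two_mul_triangular (u - w)]
  have s : (-1 : ℂ) ^ (u + w + 1) * (-1) ^ (u - w) = -1 := by
    rw [← zpow_add₀ (by norm_num), show u + w + 1 + (u - w) = 2 * u + 1 by ring,
      zpow_add₀ (by norm_num), zpow_mul]
    norm_num
  rw [← zpow_add₀ h0, ← e, zpow_add₀ h0]
  linear_combination thetaCoeff p 0 ^ 2 * p ^ triangular (u + w + 1) * p ^ triangular (u - w) * s

/-- A subfamily of the double series of E(x)^2. Along the diagonals w = 0 it is a constant multiple
of the series `evenTheta` or `oddTheta`, which therefore converge. -/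
lemma summable_thetaCoeff_mul (hp : ‖p‖ < 1) (h0 : p ≠ 0) {x : ℂ} (hx : x ≠ 0) {f : ℤ → ℤ × ℤ}
    (hf : Function.Injective f) : Summable fun u : ℤ =>
      thetaCoeff p (f u).1 * thetaCoeff p (f u).2 * x ^ ((f u).1 + (f u).2) := by
  refine ((hasSum_mul_prod (hasSum_E hp h0 hx) (hasSum_E hp h0 hx)).summable.comp_injective hf).congr
    fun u => ?_
  simp only [Function.comp, zpow_add₀ hx]
  ring

lemma hasSum_evenTheta (hp : ‖p‖ < 1) (h0 : p ≠ 0) {x : ℂ} (hx : x ≠ 0) :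
    HasSum (fun u : ℤ => p ^ (u * (u - 1)) * x ^ (2 * u)) (evenTheta p x) := by
  have h := summable_thetaCoeff_mul hp h0 hx (f := fun u => (u + 0, u - 0)) fun a b hab => by
    simpa using hab
  simp only [thetaCoeff_mul_even hp h0, mul_assoc] at h
  have h' := (summable_mul_left_iff (pow_ne_zero 2 (thetaCoeff_zero_ne_zero hp h0))).1 h
  refine Summable.hasSum (h'.congr fun u => ?_)
  rw [show u + 0 + (u - 0) = 2 * u by ring]
  simp

lemma hasSum_oddTheta (hp : ‖p‖ < 1) (h0 : p ≠ 0) {x : ℂ} (hx : x ≠ 0) :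
    HasSum (fun u : ℤ => p ^ (u ^ 2) * x ^ (2 * u + 1)) (oddTheta p x) := by
  have h := summable_thetaCoeff_mul hp h0 hx (f := fun u => (u + 0 + 1, u - 0)) fun a b hab => by
    simpa using hab
  simp only [thetaCoeff_mul_odd hp h0, mul_assoc] at h
  have h' := (summable_mul_left_iff (neg_ne_zero.2
    (pow_ne_zero 2 (thetaCoeff_zero_ne_zero hp h0)))).1 h
  refine Summable.hasSum (h'.congr fun u => ?_)
  rw [show u + 0 + 1 + (u - 0) = 2 * u + 1 by ring]
  simp

/-- Expand the product over pairs (k, l) of exponents. On each parity class of k + l, the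
substitution by u, w separates the quadratic exponent of p into a part in u and a part in w, so the
class factors. In the odd class w + 1 is the natural index of `evenTheta`, whence the shift by one.
-/
lemma E_mul_E_eq_bracket (hp : ‖p‖ < 1) (h0 : p ≠ 0) {x z : ℂ} (hx : x ≠ 0) (hz : z ≠ 0) :
    z * (E (x * z) p * E (x / z) p) =
      thetaCoeff p 0 ^ 2 * (evenTheta p x * oddTheta p z - oddTheta p x * evenTheta p z) := by
  have h1 := (hasSum_mul_prod (hasSum_E hp h0 (mul_ne_zero hx hz))
    (hasSum_E hp h0 (div_ne_zero hx hz))).mul_left z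
  have h2 := ((hasSum_mul_prod (hasSum_evenTheta hp h0 hx) (hasSum_oddTheta hp h0 hz)).mul_left
    (thetaCoeff p 0 ^ 2))
  have h3 := ((hasSum_mul_prod (hasSum_oddTheta hp h0 hx) ((Equiv.addRight (1 : ℤ)).hasSum_iff.2
    (hasSum_evenTheta hp h0 hz))).mul_left (-thetaCoeff p 0 ^ 2))
  have h4 := parityEquiv.hasSum_iff.2 h1
  have h5 := h4.unique (HasSum.sum (h2.congr_fun fun c => ?_) (h3.congr_fun fun c => ?_))
  · rw [h5]; ring
  · obtain ⟨u, w⟩ := c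
    have e := thetaCoeff_mul_even hp h0 u w
    simp only [parityEquiv, Function.comp, Equiv.coe_fn_mk, Sum.elim_inl]
    rw [show z * (thetaCoeff p (u + w) * (x * z) ^ (u + w) *
      (thetaCoeff p (u - w) * (x / z) ^ (u - w))) = (thetaCoeff p (u + w) * thetaCoeff p (u - w)) *
        (z * (x * z) ^ (u + w) * (x / z) ^ (u - w)) by ring, e]
    have : z * (x * z) ^ (u + w) * (x / z) ^ (u - w) = x ^ (2 * u) * z ^ (2 * w + 1) := by
      rw [mul_zpow, div_zpow, zpow_add₀ hx, zpow_sub₀ hx, zpow_add₀ hz, zpow_sub₀ hz,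
        zpow_add_one₀ hz, two_mul, two_mul, zpow_add₀ hx, zpow_add₀ hz]
      have := zpow_ne_zero w hx
      have := zpow_ne_zero u hz
      field_simp
    rw [this]
    ring
  · obtain ⟨u, w⟩ := c
    have e := thetaCoeff_mul_odd hp h0 u w
    simp only [parityEquiv, Function.comp, Equiv.coe_fn_mk, Sum.elim_inr, Equiv.coe_addRight]
    rw [show z * (thetaCoeff p (u + w + 1) * (x * z) ^ (u + w + 1) *
      (thetaCoeff p (u - w) * (x / z) ^ (u - w))) =
        (thetaCoeff p (u + w + 1) * thetaCoeff p (u - w)) *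
        (z * (x * z) ^ (u + w + 1) * (x / z) ^ (u - w)) by ring, e]
    have : z * (x * z) ^ (u + w + 1) * (x / z) ^ (u - w) = x ^ (2 * u + 1) * z ^ (2 * (w + 1)) := by
      rw [mul_zpow, div_zpow, zpow_add_one₀ hx, zpow_add₀ hx, zpow_sub₀ hx, zpow_add_one₀ hz,
        zpow_add₀ hz, zpow_sub₀ hz, zpow_add_one₀ hx, two_mul, two_mul, zpow_add₀ hx,
        zpow_add₀ hz (w + 1), zpow_add_one₀ hz]
      have := zpow_ne_zero w hx
      have := zpow_ne_zero u hz
      field_simp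
    rw [this]
    ring

/-- In terms of the brackets this is the Plücker relation [x,z][y,w] - [x,w][y,z] = [x,y][z,w]. -/
lemma E_weierstrass_of_ne_zero (hp : ‖p‖ < 1) (h0 : p ≠ 0) {x y z w : ℂ} (hx : x ≠ 0) (hy : y ≠ 0)
    (hz : z ≠ 0) (hw : w ≠ 0) :
    z * (E (x * z) p * E (x / z) p) * (w * (E (y * w) p * E (y / w) p)) -
      w * (E (x * w) p * E (x / w) p) * (z * (E (y * z) p * E (y / z) p)) =
      y * (E (x * y) p * E (x / y) p) * (w * (E (z * w) p * E (z / w) p)) := by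
  rw [E_mul_E_eq_bracket hp h0 hx hz, E_mul_E_eq_bracket hp h0 hy hw,
    E_mul_E_eq_bracket hp h0 hx hw, E_mul_E_eq_bracket hp h0 hy hz,
    E_mul_E_eq_bracket hp h0 hx hy, E_mul_E_eq_bracket hp h0 hz hw]
  ring

lemma E_zero_right (x : ℂ) : E x 0 = 1 - x := by
  have h : ∀ x : ℂ, infPoch x 0 = 1 - x := fun x => by
    rw [infPoch_eq_mul (by simp)]
    simp [infPoch]
  simp [E, h]

/-- The Weierstrass three-term relation. -/
lemma E_weierstrass (hp : ‖p‖ < 1) {x y z w : ℂ} (hx : x ≠ 0) (hy : y ≠ 0)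
    (hz : z ≠ 0) (hw : w ≠ 0) :
    z * (E (x * z) p * E (x / z) p) * (w * (E (y * w) p * E (y / w) p)) -
      w * (E (x * w) p * E (x / w) p) * (z * (E (y * z) p * E (y / z) p)) =
      y * (E (x * y) p * E (x / y) p) * (w * (E (z * w) p * E (z / w) p)) := by
  rcases eq_or_ne p 0 with rfl | h0
  · simp only [E_zero_right]
    field_simp
    ring
  · exact E_weierstrass_of_ne_zero hp h0 hx hy hz hw

end Weierstrass

/-! ### Consequences of inversion and the three-term relation. -/

/-- The inversion formula and the three-term relation of theta functions. -/
structure IsTheta (e : ℂ → ℂ) : Prop where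
  inv : ∀ {x : ℂ}, x ≠ 0 → e x⁻¹ = -e x / x
  three_term : ∀ {A B r s t : ℂ}, A ≠ 0 → B ≠ 0 → r ≠ 0 → s ≠ 0 → t ≠ 0 →
    t * (e (A * r) * e (B * r)) * (e (A * B * s * t) * e (s / t)) -
      t * (e (A * s) * e (B * s)) * (e (A * B * r * t) * e (r / t)) +
      s * (e (A * t) * e (B * t)) * (e (A * B * r * s) * e (r / s)) = 0

/-- Choose d with d^2 = AB and apply the Weierstrass relation at A/d, rd, sd, td. Products give As
and ABrs; the quotient of A/d by sd is 1/(Bs), which inversion turns into Bs. -/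
lemma isTheta_E {p : ℂ} (hp : ‖p‖ < 1) : IsTheta fun x => E x p where
  inv := E_inv hp
  three_term := by
    intro A B r s t hA hB hr hs ht
    obtain ⟨d, hd⟩ : ∃ d : ℂ, A * B = d ^ 2 := by
      obtain ⟨d, hd⟩ := IsAlgClosed.exists_pow_nat_eq (A * B) two_pos
      exact ⟨d, hd.symm⟩
    have hd0 : d ≠ 0 := by
      rintro rfl
      simp [hA, hB] at hd
    have h := E_weierstrass hp (div_ne_zero hA hd0) (mul_ne_zero hr hd0) (mul_ne_zero hs hd0)
      (mul_ne_zero ht hd0)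
    have h1 : ∀ s : ℂ, A / d * (s * d) = A * s := fun s => by field_simp
    have h2 : ∀ {s : ℂ}, s ≠ 0 → E (A / d / (s * d)) p = -E (B * s) p / (B * s) := fun {s} hs => by
      rw [← E_inv hp (mul_ne_zero hB hs), div_div, show d * (s * d) = A * (B * s) by
        linear_combination -s * hd]
      congr 1
      field_simp
    have h3 : ∀ r s : ℂ, r * d * (s * d) = A * B * r * s := fun r s => by rw [hd]; ring
    have h4 : ∀ r s : ℂ, r * d / (s * d) = r / s := fun r s => mul_div_mul_right _ _ hd0
    simp only [h1, h2 hr, h2 hs, h2 ht, h3, h4] at h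
    generalize E (A * r) p = x₁, E (B * r) p = x₂, E (A * B * s * t) p = x₃, E (s / t) p = x₄,
      E (A * s) p = y₁, E (B * s) p = y₂, E (A * B * r * t) p = y₃, E (r / t) p = y₄,
      E (A * t) p = z₁, E (B * t) p = z₂, E (A * B * r * s) p = z₃, E (r / s) p = z₄ at *
    field_simp at h
    linear_combination h

namespace IsTheta

variable {e : ℂ → ℂ} (h : IsTheta e)
include h

lemma one : e 1 = 0 := by
  have := h.inv one_ne_zero
  simp only [inv_one, div_one] at this
  linear_combination (1 / 2) * this

lemma three_term_of_eq {A B r s t a₁ a₂ a₃ a₄ b₁ b₂ b₃ b₄ c₁ c₂ c₃ c₄ : ℂ} (hA : A ≠ 0) (hB : B ≠ 0)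
    (hr : r ≠ 0) (hs : s ≠ 0) (ht : t ≠ 0) (ha₁ : a₁ = A * r) (ha₂ : a₂ = B * r)
    (ha₃ : a₃ = A * B * s * t) (ha₄ : a₄ = s / t) (hb₁ : b₁ = A * s) (hb₂ : b₂ = B * s)
    (hb₃ : b₃ = A * B * r * t) (hb₄ : b₄ = r / t) (hc₁ : c₁ = A * t) (hc₂ : c₂ = B * t)
    (hc₃ : c₃ = A * B * r * s) (hc₄ : c₄ = r / s) :
    t * (e a₁ * e a₂) * (e a₃ * e a₄) - t * (e b₁ * e b₂) * (e b₃ * e b₄) +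
      s * (e c₁ * e c₂) * (e c₃ * e c₄) = 0 := by
  subst_vars
  exact h.three_term hA hB hr hs ht

/-- The three-term relation at r = QC, s = Q, t = 1. Under ABC = aq it evaluates the numerator of 1
- `quadRatio`. -/
lemma one_sub_ratio {A B C Q : ℂ} (hA : A ≠ 0) (hB : B ≠ 0) (hC : C ≠ 0) (hQ : Q ≠ 0) :
    e Q * (e (B * C * Q) * e (A * C * Q) * e (A * B * Q)) -
      e (A * Q) * e (B * Q) * e (C * Q) * e (A * B * C * Q) =
    -Q * (e A * e B * e C) * e (A * B * C * Q ^ 2) := by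
  have h1 : 1 * (e (A * C * Q) * e (B * C * Q)) * (e (A * B * Q) * e Q) -
      1 * (e (A * Q) * e (B * Q)) * (e (A * B * C * Q) * e (C * Q)) +
      Q * (e A * e B) * (e (A * B * C * Q ^ 2) * e C) = 0 :=
    h.three_term_of_eq hA hB (mul_ne_zero hQ hC) hQ one_ne_zero (by ring) (by ring) (by ring)
      (by ring) (by ring) (by ring) (by ring) (by ring) (by ring) (by ring) (by ring)
      (by field_simp)
  linear_combination h1

/-- The theta identity behind the quadratic summation. -/
lemma step_identity {A B C a q u Q : ℂ} (hA : A ≠ 0) (hB : B ≠ 0) (hC : C ≠ 0) (hq : q ≠ 0)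
    (hu : u ≠ 0) (hQ : Q ≠ 0) (ha : A * B * C = a * q) (h1 : e (A * B * u * Q) ≠ 0) :
    u * e (a * u ^ 3) * (Q * e (u / (q * Q)) * e (u / Q) * e (a * Q * u ^ 2) *
        (e (B * C * Q) * e (A * C * Q) * e (A * B * Q)) +
      e (A * Q) * e (B * Q) * e (C * Q) * e (u ^ 2 / (q * Q)) * e (a * Q * u) * e (a * q * Q * u)) =
    Q * e (a * q * Q ^ 2) * (e (A * u) * e (B * u) * e (C * u) * e (a * u ^ 2) *
        e (u ^ 2 / (q * Q)) * e (a * Q * u ^ 2) -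
      e (a * u ^ 2 / A) * e (a * u ^ 2 / B) * e (a * u ^ 2 / C) * e u * e (u / Q) *
        e (a * q * Q * u)) := by
  obtain rfl : a = A * B * C / q := by field_simp; exact ha.symm
  clear ha
  set a := A * B * C / q with ha
  have hz : u ^ 2 / (q * Q) ≠ 0 := by positivity
  have i1 : e (Q / u) = -e (u / Q) / (u / Q) := by
    rw [← h.inv (div_ne_zero hu hQ), inv_div]
  have i2 : e (1 / u) = -e u / u := by rw [← h.inv hu, one_div]
  have i3 : e (q * Q / u) = -e (u / (q * Q)) / (u / (q * Q)) := by
    rw [← h.inv (by positivity), inv_div]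
  have i4 : e (q * Q / u ^ 2) = -e (u ^ 2 / (q * Q)) / (u ^ 2 / (q * Q)) := by
    rw [← h.inv hz, inv_div]
  -- The four relations share e(ABuQ). Between them they also involve e(C), e(QC/u), e(uC/q) and
  -- e(Cu²/(qQ)), which are absent from the goal and get eliminated.
  have e1 : u * (e (A * C * Q) * e (B * C * Q)) * (e (A * B * u * Q) * e (Q / u)) -
      u * (e (A * Q) * e (B * Q)) * (e (a * q * Q * u) * e (Q * C / u)) +
      Q * (e (A * u) * e (B * u)) * (e (a * q * Q ^ 2) * e C) = 0 := by
    refine h.three_term_of_eq hA hB (mul_ne_zero hQ hC) hQ hu ?_ ?_ ?_ ?_ ?_ ?_ ?_ ?_ ?_ ?_ ?_ ?_ <;>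
      (try rw [ha]) <;> field_simp
  have e2 : u * (e (a * u ^ 2 / B) * e (a * u ^ 2 / A)) * (e (A * B * u * Q) * e (Q / u)) -
      u * (e (A * Q) * e (B * Q)) * (e (a * u ^ 3) * e (u * C / q)) +
      Q * (e (A * u) * e (B * u)) * (e (a * Q * u ^ 2) * e (C * u ^ 2 / (q * Q))) = 0 := by
    refine h.three_term_of_eq hA hB (show u ^ 2 * C / q ≠ 0 by positivity) hQ hu
      ?_ ?_ ?_ ?_ ?_ ?_ ?_ ?_ ?_ ?_ ?_ ?_ <;> (try rw [ha]) <;> field_simp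
  have e3 : u ^ 2 / (q * Q) * (e (A * B * Q) * e (Q * C / u)) * (e (a * Q * u ^ 2) * e (q * Q / u)) -
      u ^ 2 / (q * Q) * (e (A * B * u * Q) * e (C * Q)) * (e (a * Q * u) * e (q * Q / u ^ 2)) +
      u * (e (a * u ^ 2 / C) * e (u * C / q)) * (e (a * q * Q ^ 2) * e (1 / u)) = 0 := by
    refine h.three_term_of_eq (show A * B * Q ≠ 0 by positivity) (show Q * C / u ≠ 0 by positivity)
      one_ne_zero hu hz ?_ ?_ ?_ ?_ ?_ ?_ ?_ ?_ ?_ ?_ ?_ ?_ <;> (try rw [ha]) <;> field_simp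
  have e4 : u ^ 2 / (q * Q) * (e (A * B * Q) * e C) * (e (a * u ^ 3) * e (q * Q / u)) -
      u ^ 2 / (q * Q) * (e (A * B * u * Q) * e (C * u)) * (e (a * u ^ 2) * e (q * Q / u ^ 2)) +
      u * (e (a * u ^ 2 / C) * e (C * u ^ 2 / (q * Q))) * (e (a * q * Q * u) * e (1 / u)) = 0 := by
    refine h.three_term_of_eq (show A * B * Q ≠ 0 by positivity) hC
      one_ne_zero hu hz ?_ ?_ ?_ ?_ ?_ ?_ ?_ ?_ ?_ ?_ ?_ ?_ <;> (try rw [ha]) <;> field_simp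
  rw [i1] at e1 e2
  rw [i2, i3, i4] at e3 e4
  clear_value a
  generalize e (A * C * Q) = x1, e (B * C * Q) = x2, e (A * B * u * Q) = x3,
    e (u / Q) = x4, e (A * Q) = x5, e (B * Q) = x6,
    e (a * q * Q * u) = x7, e (Q * C / u) = x8, e (A * u) = x9,
    e (B * u) = y1, e (a * q * Q ^ 2) = y2, e C = y3,
    e (a * u ^ 2 / B) = y4, e (a * u ^ 2 / A) = y5, e (a * u ^ 3) = y6,
    e (u * C / q) = y7, e (a * Q * u ^ 2) = y8, e (C * u ^ 2 / (q * Q)) = y9,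
    e (A * B * Q) = z1, e (u / (q * Q)) = z2, e (u ^ 2 / (q * Q)) = z3,
    e (a * Q * u) = z4, e (a * u ^ 2 / C) = z5, e (C * Q) = z6,
    e u = z7, e (C * u) = z8, e (a * u ^ 2) = z9 at *
  have f1 : -Q * x1 * x2 * x3 * x4 - u * x5 * x6 * x7 * x8 + Q * x9 * y1 * y2 * y3 = 0 := by
    rw [← e1]; field_simp
  have f2 : -Q * y4 * y5 * x3 * x4 - u * x5 * x6 * y6 * y7 + Q * x9 * y1 * y8 * y9 = 0 := by
    rw [← e2]; field_simp
  have f3 : -u * z1 * x8 * y8 * z2 + x3 * z6 * z4 * z3 - z5 * y7 * y2 * z7 = 0 := by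
    rw [← e3]; field_simp; ring
  have f4 : -u * z1 * y3 * y6 * z2 + x3 * z8 * z9 * z3 - z5 * y9 * x7 * z7 = 0 := by
    rw [← e4]; field_simp; ring
  -- The goal itself does not contain e(ABuQ); only its multiple by this factor is a combination of
  -- the four relations.
  apply mul_left_cancel₀ h1
  linear_combination (-u * y6 * z2 * y8 * z1) * f1 - y2 * z5 * z7 * x7 * f2 +
    u * y6 * x7 * x5 * x6 * f3 - Q * y2 * y8 * x9 * y1 * f4

end IsTheta

/-! ### Finite shifted factorials. -/

/-- The shifted factorial of a function `e`, with a natural subscript. -/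
def shifted (e : ℂ → ℂ) (z b : ℂ) (n : ℕ) : ℂ := ∏ k ∈ Finset.range n, e (z * b ^ k)

section Shifted

variable (e : ℂ → ℂ) (z b : ℂ) (n : ℕ)

@[simp] lemma shifted_zero : shifted e z b 0 = 1 := by simp [shifted]

lemma shifted_succ : shifted e z b (n + 1) = shifted e z b n * e (z * b ^ n) :=
  Finset.prod_range_succ _ _

lemma shifted_succ' : shifted e z b (n + 1) = e z * shifted e (z * b) b n := by
  rw [shifted, Finset.prod_range_succ', mul_comm, pow_zero, mul_one, shifted]
  congr 1
  exact Finset.prod_congr rfl fun k _ => by rw [pow_succ', mul_assoc]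

variable {e z b n}

lemma shifted_ne_zero (h : ∀ k < n, e (z * b ^ k) ≠ 0) : shifted e z b n ≠ 0 :=
  Finset.prod_ne_zero_iff.2 fun k hk => h k (Finset.mem_range.1 hk)

lemma shifted_eq_zero {k : ℕ} (hk : k < n) (h : e (z * b ^ k) = 0) : shifted e z b n = 0 :=
  Finset.prod_eq_zero (Finset.mem_range.2 hk) h

end Shifted

/-! ### Summands of the quadratic series and their common factors. -/

section QuadraticSum

/-- The part of the summand depending on `A, B, C`. -/
noncomputable def paramPart (e : ℂ → ℂ) (a q A B C : ℂ) (m : ℕ) : ℂ :=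
  shifted e A q m * shifted e B q m * shifted e C q m /
    (shifted e (a * q ^ 2 / A) (q ^ 2) m * shifted e (a * q ^ 2 / B) (q ^ 2) m *
      shifted e (a * q ^ 2 / C) (q ^ 2) m)

/-- The part of the summand depending on `Q`, which is `q ^ (2 N + 1)` for the sum over `m ≤ N`. -/
noncomputable def terminatingPart (e : ℂ → ℂ) (a q Q : ℂ) (m : ℕ) : ℂ :=
  q ^ m * e (a * q ^ (3 * m)) / e a *
    (shifted e a (q ^ 2) m * shifted e (a * Q) (q ^ 2) m * shifted e (q / Q) (q ^ 2) m /
      (shifted e q q m * shifted e (a * Q) q m * shifted e (q / Q) q m))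

/-- The value of the quadratic sum. -/
noncomputable def quadValue (e : ℂ → ℂ) (a q A B C : ℂ) (N : ℕ) : ℂ :=
  shifted e (A * q) (q ^ 2) N * shifted e (B * q) (q ^ 2) N * shifted e (C * q) (q ^ 2) N *
      shifted e (a * q ^ 2) (q ^ 2) N /
    (shifted e q (q ^ 2) N * (shifted e (a * q ^ 2 / A) (q ^ 2) N *
      shifted e (a * q ^ 2 / B) (q ^ 2) N * shifted e (a * q ^ 2 / C) (q ^ 2) N))

/-- The ratio of consecutive values of the quadratic sum. -/
noncomputable def quadRatio (e : ℂ → ℂ) (a q A B C Q : ℂ) : ℂ :=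
  e (A * Q) * e (B * Q) * e (C * Q) * e (a * q * Q) /
    (e Q * (e (B * C * Q) * e (A * C * Q) * e (A * B * Q)))

/-- The part depending on `A, B, C` in the partial sums of the telescoping relation. -/
noncomputable def telescopeParam (e : ℂ → ℂ) (a q A B C : ℂ) (m : ℕ) : ℂ :=
  shifted e (A * q) q m * shifted e (B * q) q m * shifted e (C * q) q m /
    (shifted e (a * q ^ 2 / A) (q ^ 2) m * shifted e (a * q ^ 2 / B) (q ^ 2) m *
      shifted e (a * q ^ 2 / C) (q ^ 2) m)

/-- The part depending on `Q` in the partial sums of the telescoping relation. -/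
noncomputable def telescopeTerminating (e : ℂ → ℂ) (a q Q : ℂ) (m : ℕ) : ℂ :=
  shifted e (a * q ^ 2) (q ^ 2) m * shifted e (a * q ^ 2 * Q) (q ^ 2) m *
      shifted e (q / Q) (q ^ 2) m /
    (shifted e q q m * shifted e (a * q ^ 2 * Q) q m * shifted e (q / Q) q m)

/-- The factor depending on `A, B, C` common to the terms of the telescoping relation. -/
noncomputable def commonParam (e : ℂ → ℂ) (a q A B C : ℂ) (m : ℕ) : ℂ :=
  shifted e (A * q) q m * shifted e (B * q) q m * shifted e (C * q) q m /
    (shifted e (a * q ^ 2 / A) (q ^ 2) (m + 1) * shifted e (a * q ^ 2 / B) (q ^ 2) (m + 1) *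
      shifted e (a * q ^ 2 / C) (q ^ 2) (m + 1))

/-- The factor depending on `Q` common to the terms of the telescoping relation. -/
noncomputable def commonTerminating (e : ℂ → ℂ) (a q Q : ℂ) (m : ℕ) : ℂ :=
  shifted e (a * q ^ 2) (q ^ 2) m * shifted e (a * q ^ 2 * Q) (q ^ 2) m *
      shifted e (q / Q) (q ^ 2) m /
    (shifted e q q (m + 1) * shifted e (a * q ^ 2 * Q) q (m + 1) * shifted e (q / Q) q m)

variable {e : ℂ → ℂ} {a q A B C Q : ℂ} {m : ℕ}

lemma shifted_div_last (hq : q ≠ 0) : shifted e (q / Q) (q ^ 2) (m + 1) =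
    shifted e (q / Q) (q ^ 2) m * e ((q ^ (m + 1)) ^ 2 / (q * Q)) := by
  rw [shifted_succ]; congr 2; field_simp; ring

lemma shifted_div_last' : shifted e (q / Q) q (m + 1) =
    shifted e (q / Q) q m * e (q ^ (m + 1) / Q) := by
  rw [shifted_succ]; congr 2; ring

lemma shifted_sq_last : shifted e (a * q ^ 2 * Q) (q ^ 2) (m + 1) =
    shifted e (a * q ^ 2 * Q) (q ^ 2) m * e (a * Q * (q ^ (m + 1)) ^ 2) := by
  rw [shifted_succ]; congr 2; ring

lemma paramPart_succ : paramPart e a q A B C (m + 1) =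
    commonParam e a q A B C m * (e A * e B * e C) := by
  rw [paramPart, commonParam, shifted_succ' e A, shifted_succ' e B, shifted_succ' e C]
  ring

/-- Replacing Q by Qq² is the passage from N to N + 1. The products (q/Q; q)_m and (1/Q; q)_m differ
only in their end factors, which produces the quotient e(u/(qQ)) / e(1/Q) with u = q^(m+1). -/
lemma terminatingPart_next (hq : q ≠ 0) (hQ : Q ≠ 0) (ha : e a ≠ 0) (h1 : e (1 / (q * Q)) ≠ 0)
    (h2 : e (1 / Q) ≠ 0) (h3 : shifted e (q / Q) q m ≠ 0) (h4 : shifted e (1 / Q) q m ≠ 0) :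
    terminatingPart e a q (Q * q ^ 2) (m + 1) =
      commonTerminating e a q Q m * (q ^ (m + 1) * e (a * (q ^ (m + 1)) ^ 3) *
        e (q ^ (m + 1) / (q * Q)) / e (1 / Q) * e (a * Q * (q ^ (m + 1)) ^ 2)) := by
  have r1 : shifted e (q / (Q * q ^ 2)) (q ^ 2) (m + 1) =
      e (1 / (q * Q)) * shifted e (q / Q) (q ^ 2) m := by
    rw [shifted_succ']; congr 2 <;> field_simp
  have r2 : shifted e (q / (Q * q ^ 2)) q (m + 1) = e (1 / (q * Q)) * shifted e (1 / Q) q m := by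
    rw [shifted_succ']; congr 2 <;> field_simp
  have r3 : e (1 / Q) * shifted e (q / Q) q m =
      shifted e (1 / Q) q m * e (q ^ (m + 1) / (q * Q)) := by
    have := (shifted_succ' e (1 / Q) q m).symm.trans (shifted_succ e (1 / Q) q m)
    convert this using 3
    · field_simp
    · rw [pow_succ']; field_simp
  have r4 : e (q ^ (m + 1) / (q * Q)) / e (1 / Q) / shifted e (q / Q) q m =
      1 / shifted e (1 / Q) q m := by
    rw [div_div, div_eq_div_iff (mul_ne_zero h2 h3) h4, r3]; ring
  have r5 : e (1 / (q * Q)) / e (1 / (q * Q)) = 1 := div_self h1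
  have r6 : e a / e a = 1 := div_self ha
  rw [terminatingPart, commonTerminating, r1, r2, show a * (Q * q ^ 2) = a * q ^ 2 * Q by ring,
    shifted_sq_last, shifted_succ' e a, show q ^ (3 * (m + 1)) = (q ^ (m + 1)) ^ 3 by ring]
  calc _ = q ^ (m + 1) * e (a * (q ^ (m + 1)) ^ 3) * shifted e (a * q ^ 2) (q ^ 2) m *
        shifted e (a * q ^ 2 * Q) (q ^ 2) m * e (a * Q * (q ^ (m + 1)) ^ 2) *
        shifted e (q / Q) (q ^ 2) m / (shifted e q q (m + 1) * shifted e (a * q ^ 2 * Q) q (m + 1)) *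
        (e a / e a) * (e (1 / (q * Q)) / e (1 / (q * Q))) * (1 / shifted e (1 / Q) q m) := by ring
    _ = _ := by rw [r5, r6, ← r4]; ring

/-- The extra factor e(u/Q), u = q^(m+1), removes the last factor of (q/Q; q)_(m+1), so that the
common denominator stops at subscript m. -/
lemma terminatingPart_same (hq : q ≠ 0) (ha : e a ≠ 0)
    (h2 : e (a * q * Q) ≠ 0) (h3 : e (q ^ (m + 1) / Q) ≠ 0)
    (h4 : shifted e (a * q ^ 2 * Q) q (m + 1) ≠ 0) (h5 : shifted e (a * Q) q (m + 1) ≠ 0) :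
    terminatingPart e a q Q (m + 1) * e (q ^ (m + 1) / Q) =
      commonTerminating e a q Q m * (q ^ (m + 1) * e (a * (q ^ (m + 1)) ^ 3) *
        e ((q ^ (m + 1)) ^ 2 / (q * Q)) * e (a * Q * q ^ (m + 1)) *
        e (a * q * Q * q ^ (m + 1)) / e (a * q * Q)) := by
  have r1 : shifted e (a * Q) (q ^ 2) (m + 1) = e (a * Q) * shifted e (a * q ^ 2 * Q) (q ^ 2) m := by
    rw [shifted_succ']; congr 2; ring
  have r2 : e (a * Q) * e (a * q * Q) * shifted e (a * q ^ 2 * Q) q (m + 1) =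
      shifted e (a * Q) q (m + 1) * e (a * Q * q ^ (m + 1)) * e (a * q * Q * q ^ (m + 1)) := by
    have := (shifted_succ' e (a * Q) q (m + 2)).symm.trans (shifted_succ e (a * Q) q (m + 2))
    rw [shifted_succ', shifted_succ e (a * Q) q (m + 1), ← mul_assoc] at this
    rw [show a * q * Q = a * Q * q by ring, show a * q ^ 2 * Q = a * Q * q * q by ring, this,
      show a * Q * q * q ^ (m + 1) = a * Q * q ^ (m + 2) by ring]
  have r3 : e (a * Q) / shifted e (a * Q) q (m + 1) = e (a * Q * q ^ (m + 1)) *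
      e (a * q * Q * q ^ (m + 1)) / (e (a * q * Q) * shifted e (a * q ^ 2 * Q) q (m + 1)) := by
    rw [div_eq_div_iff h5 (mul_ne_zero h2 h4)]
    linear_combination r2
  have r4 : e (q ^ (m + 1) / Q) / e (q ^ (m + 1) / Q) = 1 := div_self h3
  have r5 : e a / e a = 1 := div_self ha
  rw [terminatingPart, commonTerminating, r1, shifted_div_last hq, shifted_div_last',
    shifted_succ' e a, show q ^ (3 * (m + 1)) = (q ^ (m + 1)) ^ 3 by ring]
  calc _ = q ^ (m + 1) * e (a * (q ^ (m + 1)) ^ 3) * shifted e (a * q ^ 2) (q ^ 2) m *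
        shifted e (a * q ^ 2 * Q) (q ^ 2) m * shifted e (q / Q) (q ^ 2) m *
        e ((q ^ (m + 1)) ^ 2 / (q * Q)) / (shifted e q q (m + 1) * shifted e (q / Q) q m) *
        (e a / e a) * (e (q ^ (m + 1) / Q) / e (q ^ (m + 1) / Q)) *
        (e (a * Q) / shifted e (a * Q) q (m + 1)) := by ring
    _ = _ := by rw [r3, r4, r5]; ring

lemma telescopeParam_same (h1 : e (a * (q ^ (m + 1)) ^ 2 / A) ≠ 0)
    (h2 : e (a * (q ^ (m + 1)) ^ 2 / B) ≠ 0) (h3 : e (a * (q ^ (m + 1)) ^ 2 / C) ≠ 0) :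
    telescopeParam e a q A B C m = commonParam e a q A B C m * (e (a * (q ^ (m + 1)) ^ 2 / A) *
      e (a * (q ^ (m + 1)) ^ 2 / B) * e (a * (q ^ (m + 1)) ^ 2 / C)) := by
  have r : ∀ z, shifted e (a * q ^ 2 / z) (q ^ 2) (m + 1) =
      shifted e (a * q ^ 2 / z) (q ^ 2) m * e (a * (q ^ (m + 1)) ^ 2 / z) := fun z => by
    rw [shifted_succ]; congr 2; ring
  rw [telescopeParam, commonParam, r, r, r, div_mul_eq_mul_div]
  refine (mul_div_mul_right _ _ (mul_ne_zero (mul_ne_zero h1 h2) h3)).symm.trans ?_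
  congr 1
  ring

lemma telescopeTerminating_same (h1 : e (q ^ (m + 1)) ≠ 0) (h2 : e (a * q * Q * q ^ (m + 1)) ≠ 0) :
    telescopeTerminating e a q Q m = commonTerminating e a q Q m *
      (e (q ^ (m + 1)) * e (a * q * Q * q ^ (m + 1))) := by
  have r1 : shifted e q q (m + 1) = shifted e q q m * e (q ^ (m + 1)) := by
    rw [shifted_succ]; congr 2; ring
  have r2 : shifted e (a * q ^ 2 * Q) q (m + 1) =
      shifted e (a * q ^ 2 * Q) q m * e (a * q * Q * q ^ (m + 1)) := by
    rw [shifted_succ]; congr 2; ring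
  rw [telescopeTerminating, commonTerminating, r1, r2, div_mul_eq_mul_div]
  refine (mul_div_mul_right _ _ (mul_ne_zero h1 h2)).symm.trans ?_
  congr 1
  ring

lemma telescopeParam_succ : telescopeParam e a q A B C (m + 1) = commonParam e a q A B C m *
    (e (A * q ^ (m + 1)) * e (B * q ^ (m + 1)) * e (C * q ^ (m + 1))) := by
  have r : ∀ z, shifted e (z * q) q (m + 1) = shifted e (z * q) q m * e (z * q ^ (m + 1)) :=
    fun z => by rw [shifted_succ]; congr 2; ring
  rw [telescopeParam, commonParam, r, r, r]
  ring

lemma telescopeTerminating_succ (hq : q ≠ 0) (h1 : e (q ^ (m + 1) / Q) ≠ 0) :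
    telescopeTerminating e a q Q (m + 1) * e (q ^ (m + 1) / Q) = commonTerminating e a q Q m *
      (e (a * (q ^ (m + 1)) ^ 2) * e ((q ^ (m + 1)) ^ 2 / (q * Q)) *
        e (a * Q * (q ^ (m + 1)) ^ 2)) := by
  have r4 : shifted e (a * q ^ 2) (q ^ 2) (m + 1) =
      shifted e (a * q ^ 2) (q ^ 2) m * e (a * (q ^ (m + 1)) ^ 2) := by
    rw [shifted_succ]; congr 2; ring
  rw [telescopeTerminating, commonTerminating, shifted_div_last hq, shifted_div_last',
    shifted_sq_last, r4, div_mul_eq_mul_div, ← mul_assoc (_ * _) (shifted e (q / Q) q m),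
    mul_div_mul_right _ _ h1]
  ring

end QuadraticSum

/-! ### The quadratic summation, by induction on N. -/

/-- Nonvanishing conditions for the quadratic sum. -/
structure QuadGeneric (e : ℂ → ℂ) (a q A B C : ℂ) : Prop where
  q0 : q ≠ 0
  A0 : A ≠ 0
  B0 : B ≠ 0
  C0 : C ≠ 0
  balance : A * B * C = a * q
  base : ∀ m : ℤ, m ≠ 0 → e (q ^ m) ≠ 0
  param : ∀ m : ℕ, e (a * q ^ m) ≠ 0
  divA : ∀ m : ℕ, e (a * q ^ m / A) ≠ 0
  divB : ∀ m : ℕ, e (a * q ^ m / B) ≠ 0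
  divC : ∀ m : ℕ, e (a * q ^ m / C) ≠ 0

variable {e : ℂ → ℂ} {a q A B C : ℂ}

/-- The free factor D allows 1/e(1/Q) to be written over the denominator of `quadRatio`. -/
lemma IsTheta.inv_one_div (h : IsTheta e) {Q D : ℂ} (hQ : Q ≠ 0) (hQ' : e Q ≠ 0) (hD : D ≠ 0) :
    (e (1 / Q))⁻¹ = -Q * D * (e Q * D)⁻¹ := by
  rw [one_div, h.inv hQ]
  field_simp

section

variable (N : ℕ) (hg : QuadGeneric e a q A B C)
include hg

namespace QuadGeneric

lemma base_nat (m : ℕ) : e (q ^ (m + 1)) ≠ 0 := by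
  exact_mod_cast hg.base (m + 1 : ℕ) (by omega)

lemma base_div {m n : ℕ} (h : m ≠ n) : e (q ^ m / q ^ n) ≠ 0 := by
  have := hg.base (m - n) (by omega)
  rwa [zpow_sub₀ hg.q0, zpow_natCast, zpow_natCast] at this

lemma BC (m : ℕ) : e (B * C * q ^ m) ≠ 0 := by
  have h := hg.divA (m + 1)
  rwa [show a * q ^ (m + 1) / A = B * C * q ^ m by
    rw [div_eq_iff hg.A0]; linear_combination -q ^ m * hg.balance] at h

lemma AC (m : ℕ) : e (A * C * q ^ m) ≠ 0 := by
  have h := hg.divB (m + 1)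
  rwa [show a * q ^ (m + 1) / B = A * C * q ^ m by
    rw [div_eq_iff hg.B0]; linear_combination -q ^ m * hg.balance] at h

lemma AB (m : ℕ) : e (A * B * q ^ m) ≠ 0 := by
  have h := hg.divC (m + 1)
  rwa [show a * q ^ (m + 1) / C = A * B * q ^ m by
    rw [div_eq_iff hg.C0]; linear_combination -q ^ m * hg.balance] at h

lemma shifted_base {m : ℕ} (h : m ≤ N) : shifted e (q / q ^ (2 * N + 1)) q m ≠ 0 := by
  refine shifted_ne_zero fun k hk => ?_
  have := hg.base_div (m := k + 1) (n := 2 * N + 1) (by omega)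
  rwa [pow_succ', mul_div_right_comm] at this

lemma shifted_base' {m : ℕ} (h : m ≤ N) : shifted e (1 / q ^ (2 * N + 1)) q m ≠ 0 := by
  refine shifted_ne_zero fun k hk => ?_
  have := hg.base_div (m := k) (n := 2 * N + 1) (by omega)
  rwa [one_div_mul_eq_div]

lemma shifted_param (k m : ℕ) : shifted e (a * q ^ k) q m ≠ 0 :=
  shifted_ne_zero fun j _ => by
    rw [mul_assoc, ← pow_add]
    exact hg.param _

lemma quadValue_succ : quadValue e a q A B C (N + 1) =
    quadValue e a q A B C N * quadRatio e a q A B C (q ^ (2 * N + 1)) := by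
  have r : ∀ z, z * q * (q ^ 2) ^ N = z * q ^ (2 * N + 1) := fun z => by ring
  have r0 : q * (q ^ 2) ^ N = q ^ (2 * N + 1) := by ring
  have rA : a * q ^ 2 / A * (q ^ 2) ^ N = B * C * q ^ (2 * N + 1) := by
    have := hg.A0
    field_simp
    linear_combination -q ^ (2 * N + 1) * hg.balance
  have rB : a * q ^ 2 / B * (q ^ 2) ^ N = A * C * q ^ (2 * N + 1) := by
    have := hg.B0
    field_simp
    linear_combination -q ^ (2 * N + 1) * hg.balance
  have rC : a * q ^ 2 / C * (q ^ 2) ^ N = A * B * q ^ (2 * N + 1) := by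
    have := hg.C0
    field_simp
    linear_combination -q ^ (2 * N + 1) * hg.balance
  have ra : a * q ^ 2 * (q ^ 2) ^ N = a * q * q ^ (2 * N + 1) := by ring
  simp only [quadValue, quadRatio, shifted_succ, r, r0, rA, rB, rC, ra]
  ring

lemma one_sub_quadRatio (h : IsTheta e) (Q : ℂ) (hQ : Q ≠ 0) (hQ' : e Q ≠ 0)
    (hD : e (B * C * Q) * e (A * C * Q) * e (A * B * Q) ≠ 0) :
    1 - quadRatio e a q A B C Q = -Q * (e A * e B * e C) * e (a * q * Q ^ 2) *
      (e Q * (e (B * C * Q) * e (A * C * Q) * e (A * B * Q)))⁻¹ := by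
  have := h.one_sub_ratio hg.A0 hg.B0 hg.C0 hQ
  rw [hg.balance] at this
  rw [← this, quadRatio]
  generalize e (B * C * Q) * e (A * C * Q) * e (A * B * Q) = D at *
  field_simp

/-- Both sides are 1 - R at M = 0. For the step, every term is the common factor times theta
functions of u = q^(M+1) and Q = q^(2N+1), and what remains is `step_identity`. -/
lemma partial_sum (h : IsTheta e) {M : ℕ} (hM : M ≤ N) :
    ∑ m ∈ Finset.range (M + 1), (paramPart e a q A B C m *
      terminatingPart e a q (q ^ (2 * N + 1) * q ^ 2) m -
      quadRatio e a q A B C (q ^ (2 * N + 1)) *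
        (paramPart e a q A B C m * terminatingPart e a q (q ^ (2 * N + 1)) m)) =
    (1 - quadRatio e a q A B C (q ^ (2 * N + 1))) *
      (telescopeParam e a q A B C M * telescopeTerminating e a q (q ^ (2 * N + 1)) M) := by
  induction M with
  | zero =>
    have := hg.param 0
    rw [pow_zero, mul_one] at this
    simp [paramPart, terminatingPart, telescopeParam, telescopeTerminating, this]
  | succ M ih =>
    rw [Finset.sum_range_succ, ih (by omega)]
    have hq := hg.q0
    have hX : e (q ^ (M + 1) / q ^ (2 * N + 1)) ≠ 0 := hg.base_div (by omega)
    have hD : e (B * C * q ^ (2 * N + 1)) * e (A * C * q ^ (2 * N + 1)) *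
        e (A * B * q ^ (2 * N + 1)) ≠ 0 :=
      mul_ne_zero (mul_ne_zero (hg.BC _) (hg.AC _)) (hg.AB _)
    have hQ' : e (q ^ (2 * N + 1)) ≠ 0 := hg.base_nat _
    have e1 : e (1 / (q * q ^ (2 * N + 1))) ≠ 0 := by
      have := hg.base_div (m := 0) (n := 2 * N + 2) (by omega)
      rwa [pow_zero, show 2 * N + 2 = 2 * N + 1 + 1 from rfl, pow_succ'] at this
    have e2 : e (1 / q ^ (2 * N + 1)) ≠ 0 := by
      simpa using hg.base_div (m := 0) (n := 2 * N + 1) (by omega)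
    have e3 : e a ≠ 0 := by simpa using hg.param 0
    have e4 : e (a * q * q ^ (2 * N + 1)) ≠ 0 := by
      rw [mul_assoc, ← pow_succ']; exact hg.param _
    have e5 : e (a * q * q ^ (2 * N + 1) * q ^ (M + 1)) ≠ 0 := by
      rw [mul_assoc a, ← pow_succ', mul_assoc, ← pow_add]; exact hg.param _
    have e6 : e (A * B * q ^ (M + 1) * q ^ (2 * N + 1)) ≠ 0 := by
      rw [mul_assoc, ← pow_add]; exact hg.AB _
    have e7 : shifted e (a * q ^ 2 * q ^ (2 * N + 1)) q (M + 1) ≠ 0 := by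
      rw [mul_assoc a, ← pow_add]; exact hg.shifted_param _ _
    have f1 := terminatingPart_next (m := M) hq (pow_ne_zero (2 * N + 1) hq) e3 e1 e2
      (hg.shifted_base N (by omega)) (hg.shifted_base' N (by omega))
    have f2 := terminatingPart_same (m := M) hq e3 e4 hX e7 (hg.shifted_param _ _)
    have d : ∀ z : ℂ, a * (q ^ (M + 1)) ^ 2 / z = a * q ^ ((M + 1) * 2) / z := fun z => by
      rw [pow_mul]
    have f3 := telescopeParam_same (e := e) (a := a) (q := q) (A := A) (B := B) (C := C) (m := M)
      (by rw [d]; exact hg.divA _) (by rw [d]; exact hg.divB _) (by rw [d]; exact hg.divC _)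
    have f4 := telescopeTerminating_same (hg.base_nat M) e5
    have f5 := telescopeParam_succ (e := e) (a := a) (q := q) (A := A) (B := B) (C := C) (m := M)
    have f6 := telescopeTerminating_succ (a := a) hq hX
    have f7 := paramPart_succ (e := e) (a := a) (q := q) (A := A) (B := B) (C := C) (m := M)
    have g1 := hg.one_sub_quadRatio h _ (pow_ne_zero (2 * N + 1) hq) hQ' hD
    have g2 : quadRatio e a q A B C (q ^ (2 * N + 1)) / e (a * q * q ^ (2 * N + 1)) =
      e (A * q ^ (2 * N + 1)) * e (B * q ^ (2 * N + 1)) * e (C * q ^ (2 * N + 1)) *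
      (e (q ^ (2 * N + 1)) * (e (B * C * q ^ (2 * N + 1)) * e (A * C * q ^ (2 * N + 1)) *
        e (A * B * q ^ (2 * N + 1))))⁻¹ := by
      rw [quadRatio, div_div, mul_comm _ (e (a * q * q ^ (2 * N + 1))),
        mul_comm _ (e (a * q * q ^ (2 * N + 1))), mul_div_mul_left _ _ e4, div_eq_mul_inv]
    have g3 := h.inv_one_div (pow_ne_zero (2 * N + 1) hq) hQ' hD
    have key := h.step_identity hg.A0 hg.B0 hg.C0 hq (pow_ne_zero (M + 1) hq)
      (pow_ne_zero (2 * N + 1) hq) hg.balance e6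
    apply mul_right_cancel₀ hX
    rw [div_eq_mul_inv _ (e (1 / q ^ (2 * N + 1))), g3] at f1
    rw [g1, f7, f1, f3, f4, f5]
    generalize (e (q ^ (2 * N + 1)) * (e (B * C * q ^ (2 * N + 1)) * e (A * C * q ^ (2 * N + 1)) *
        e (A * B * q ^ (2 * N + 1))))⁻¹ = w at *
    have f2' : quadRatio e a q A B C (q ^ (2 * N + 1)) * (terminatingPart e a q (q ^ (2 * N + 1))
      (M + 1) * e (q ^ (M + 1) / q ^ (2 * N + 1))) = commonTerminating e a q (q ^ (2 * N + 1)) M *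
        (q ^ (M + 1) * e (a * (q ^ (M + 1)) ^ 3) *
        e ((q ^ (M + 1)) ^ 2 / (q * q ^ (2 * N + 1))) * e (a * q ^ (2 * N + 1) * q ^ (M + 1)) *
        e (a * q * q ^ (2 * N + 1) * q ^ (M + 1))) * (e (A * q ^ (2 * N + 1)) *
        e (B * q ^ (2 * N + 1)) * e (C * q ^ (2 * N + 1)) * w) := by
      rw [f2, ← g2]; ring
    generalize q ^ (2 * N + 1) = Q at *
    generalize q ^ (M + 1) = u at *
    linear_combination (-commonParam e a q A B C M * (e A * e B * e C)) * f2' +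
      Q * (e A * e B * e C) * e (a * q * Q ^ 2) * w * commonParam e a q A B C M *
        (e (A * u) * e (B * u) * e (C * u)) * f6 -
      commonParam e a q A B C M * commonTerminating e a q Q M * (e A * e B * e C) * w * key

/-- The summand m = N + 1 has no partner in the sum for N. Here u = q^(N+1) satisfies u² = qQ, so
u/(qQ) = 1/u and inversion identifies the summand with minus the boundary term. -/
lemma last_summand (h : IsTheta e) :
    paramPart e a q A B C (N + 1) * terminatingPart e a q (q ^ (2 * N + 1) * q ^ 2) (N + 1) =
    -((1 - quadRatio e a q A B C (q ^ (2 * N + 1))) *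
      (telescopeParam e a q A B C N * telescopeTerminating e a q (q ^ (2 * N + 1)) N)) := by
  have hq := hg.q0
  have hD : e (B * C * q ^ (2 * N + 1)) * e (A * C * q ^ (2 * N + 1)) *
      e (A * B * q ^ (2 * N + 1)) ≠ 0 :=
    mul_ne_zero (mul_ne_zero (hg.BC _) (hg.AC _)) (hg.AB _)
  have hQ' : e (q ^ (2 * N + 1)) ≠ 0 := hg.base_nat _
  have e1 : e (1 / (q * q ^ (2 * N + 1))) ≠ 0 := by
    have := hg.base_div (m := 0) (n := 2 * N + 2) (by omega)
    rwa [pow_zero, show 2 * N + 2 = 2 * N + 1 + 1 from rfl, pow_succ'] at this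
  have e2 : e (1 / q ^ (2 * N + 1)) ≠ 0 := by
    simpa using hg.base_div (m := 0) (n := 2 * N + 1) (by omega)
  have e3 : e a ≠ 0 := by simpa using hg.param 0
  have e5 : e (a * q * q ^ (2 * N + 1) * q ^ (N + 1)) ≠ 0 := by
    rw [mul_assoc a, ← pow_succ', mul_assoc, ← pow_add]; exact hg.param _
  have f1 := terminatingPart_next (m := N) hq (pow_ne_zero (2 * N + 1) hq) e3 e1 e2
    (hg.shifted_base N le_rfl) (hg.shifted_base' N le_rfl)
  have d : ∀ z : ℂ, a * (q ^ (N + 1)) ^ 2 / z = a * q ^ ((N + 1) * 2) / z := fun z => by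
    rw [pow_mul]
  have f3 := telescopeParam_same (e := e) (a := a) (q := q) (A := A) (B := B) (C := C) (m := N)
    (by rw [d]; exact hg.divA _) (by rw [d]; exact hg.divB _) (by rw [d]; exact hg.divC _)
  have f4 := telescopeTerminating_same (hg.base_nat N) e5
  have g1 := hg.one_sub_quadRatio h _ (pow_ne_zero (2 * N + 1) hq) hQ' hD
  have g3 := h.inv_one_div (pow_ne_zero (2 * N + 1) hq) hQ' hD
  have hu : e (q ^ (N + 1) / (q * q ^ (2 * N + 1))) = -e (q ^ (N + 1)) / q ^ (N + 1) := by
    rw [← h.inv (pow_ne_zero _ hq)]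
    congr 1
    field_simp
    ring
  have d1 : a * (q ^ (N + 1)) ^ 3 = a * q * q ^ (2 * N + 1) * q ^ (N + 1) := by ring
  have d2 : a * q ^ (2 * N + 1) * (q ^ (N + 1)) ^ 2 = a * q * (q ^ (2 * N + 1)) ^ 2 := by ring
  have d3 : a * (q ^ (N + 1)) ^ 2 / A = B * C * q ^ (2 * N + 1) := by
    rw [div_eq_iff hg.A0]; linear_combination -q ^ (2 * N + 1) * hg.balance
  have d4 : a * (q ^ (N + 1)) ^ 2 / B = A * C * q ^ (2 * N + 1) := by
    rw [div_eq_iff hg.B0]; linear_combination -q ^ (2 * N + 1) * hg.balance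
  have d5 : a * (q ^ (N + 1)) ^ 2 / C = A * B * q ^ (2 * N + 1) := by
    rw [div_eq_iff hg.C0]; linear_combination -q ^ (2 * N + 1) * hg.balance
  have hu0 : q ^ (N + 1) * (q ^ (N + 1))⁻¹ = 1 := mul_inv_cancel₀ (pow_ne_zero _ hq)
  rw [div_eq_mul_inv _ (e (1 / q ^ (2 * N + 1))), g3] at f1
  rw [g1, paramPart_succ, f1, f3, f4, hu, d1, d2, d3, d4, d5, div_eq_mul_inv _ (q ^ (N + 1))]
  generalize (e (q ^ (2 * N + 1)) * (e (B * C * q ^ (2 * N + 1)) * e (A * C * q ^ (2 * N + 1)) *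
        e (A * B * q ^ (2 * N + 1))))⁻¹ = w at *
  generalize (q ^ (N + 1))⁻¹ = v at *
  generalize q ^ (2 * N + 1) = Q at *
  generalize q ^ (N + 1) = u at *
  linear_combination (commonParam e a q A B C N * (e A * e B * e C) * commonTerminating e a q Q N *
    e (a * q * Q * u) * e u * e (a * q * Q ^ 2) * Q * (e (B * C * Q) * e (A * C * Q) *
      e (A * B * Q)) * w) * hu0

/-- A terminating quadratic summation for elliptic hypergeometric series. -/
theorem sum_eq_quadValue (h : IsTheta e) :
    ∑ m ∈ Finset.range (N + 1), paramPart e a q A B C m *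
      terminatingPart e a q (q ^ (2 * N + 1)) m = quadValue e a q A B C N := by
  induction N with
  | zero =>
    have := hg.param 0
    rw [pow_zero, mul_one] at this
    simp [paramPart, terminatingPart, quadValue, this]
  | succ N ih =>
    have h1 := hg.partial_sum N h le_rfl
    have h2 := hg.last_summand N h
    rw [Finset.sum_sub_distrib, ← Finset.mul_sum, ih] at h1
    rw [show q ^ (2 * (N + 1) + 1) = q ^ (2 * N + 1) * q ^ 2 by ring, Finset.sum_range_succ,
      hg.quadValue_succ N]
    linear_combination h1 + h2

end QuadGeneric
end

/-! ### Generic parameters and the matrix entries. -/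

/-- No nontrivial monomial in `q, x, y` is a zero of `E`. -/
structure Generic (p q x y : ℂ) : Prop where
  q0 : q ≠ 0
  x0 : x ≠ 0
  y0 : y ≠ 0
  ne_zero : ∀ a b c : ℤ, (a ≠ 0 ∨ b ≠ 0 ∨ c ≠ 0) → E (q ^ a * x ^ b * y ^ c) p ≠ 0

section Entries

variable {p q x y : ℂ}

lemma ellPoch_natCast (a b p : ℂ) (n : ℕ) : ellPoch a b p n = shifted (fun z => E z p) a b n := by
  simp [ellPoch, shifted]

/-- For m < 0 the recursion merely adds a factor to an inverted product, and with 0⁻¹ = 0 it holds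
even if that factor vanishes. For m ≥ 0 a factor has to be cancelled. -/
lemma ellPoch_pred {a b : ℂ} {m : ℤ} (h : 0 ≤ m → E (a * b ^ m) p ≠ 0) :
    ellPoch a b p m = ellPoch a b p (m + 1) * (E (a * b ^ m) p)⁻¹ := by
  rcases le_or_gt 0 m with hm | hm
  · lift m to ℕ using hm
    have h' : E (a * b ^ m) p ≠ 0 := by simpa using h
    have e : (m : ℤ) + 1 = (m + 1 : ℕ) := by push_cast; rfl
    rw [e, ellPoch_natCast, ellPoch_natCast, shifted_succ, zpow_natCast, mul_assoc,
      mul_inv_cancel₀ h', mul_one]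
  · obtain ⟨k, rfl⟩ : ∃ k : ℕ, m = -(k + 1 : ℕ) := ⟨(-m - 1).toNat, by omega⟩
    have e1 : (-(-((k + 1 : ℕ) : ℤ))).toNat = k + 1 := by omega
    have e2 : (-(-((k + 1 : ℕ) : ℤ) + 1)).toNat = k := by omega
    have h2 : ellPoch a b p (-((k + 1 : ℕ) : ℤ) + 1) =
        1 / ∏ j ∈ Finset.range k, E (a * b ^ (-((k + 1 : ℕ) : ℤ) + 1 + (j : ℤ))) p := by
      -- For m = -1 the subscript m + 1 = 0 lies in the other branch of the definition.
      rcases Nat.eq_zero_or_pos k with rfl | hk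
      · simp [ellPoch]
      · rw [ellPoch, if_neg (by omega), e2]
    rw [h2, ellPoch, if_neg (by omega), e1, Finset.prod_range_succ']
    simp only [Nat.cast_zero, add_zero, Nat.cast_add, Nat.cast_one, one_div, mul_inv]
    congr 2
    refine Finset.prod_congr rfl fun j _ => ?_
    congr 3
    ring

lemma entry_self (i : ℤ) : entry x y q p i i = 1 := by
  simp [entry, ellPochs, ellPoch]

/-- The specialization attached to row I + 1; balance holds because all powers of q depending on I
cancel in ABC = x²q². -/
lemma quadGeneric (hg : Generic p q x y) (I : ℕ) :
    QuadGeneric (fun z => E z p) (x ^ 2 * q) q (x * y * q ^ (I + 1)) (x * q ^ (I + 2) / y)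
      (1 / q ^ (2 * I + 1)) := by
  have hq := hg.q0
  have hx := hg.x0
  have hy := hg.y0
  refine ⟨hq, by positivity, by positivity, one_div_ne_zero (pow_ne_zero _ hq), ?_, fun m hm => ?_, fun m => ?_,
    fun m => ?_, fun m => ?_, fun m => ?_⟩
  · field_simp; ring
  · simpa using hg.ne_zero m 0 0 (by simpa using hm)
  · convert hg.ne_zero (m + 1) 2 0 (by simp) using 2
    rw [zpow_add_one₀ hq, zpow_natCast, zpow_zero]
    norm_cast
    ring
  · convert hg.ne_zero (m - I) 1 (-1) (by simp) using 2
    rw [zpow_sub₀ hq, zpow_natCast, zpow_natCast, zpow_one, zpow_neg_one]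
    field_simp
    ring
  · convert hg.ne_zero (m - I - 1) 1 1 (by simp) using 2
    rw [zpow_sub₀ hq, zpow_sub₀ hq, zpow_natCast, zpow_natCast, zpow_one, zpow_one, zpow_one]
    field_simp
    ring
  · convert hg.ne_zero (m + 2 * I + 2) 2 0 (by simp) using 2
    rw [show (m : ℤ) + 2 * I + 2 = (m + 2 * I + 2 : ℕ) by push_cast; ring, zpow_natCast, zpow_zero]
    norm_cast
    field_simp
    ring

/-- Each of the six shifted factorials changes by one theta function, whose argument is the
reciprocal of the one in the series. Inversion is applied to all six: the signs cancel and the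
multipliers combine to x²q·q^(4+3m). -/
lemma entry_succ_right (hp : ‖p‖ < 1) (hg : Generic p q x y) (I m : ℕ) :
    entry x y q p ((I : ℤ) + 1) ((m : ℤ) + 1 + 1) = entry x y q p ((I : ℤ) + 1) ((m : ℤ) + 1) *
      (x ^ 2 * q * q ^ (4 + 3 * m)) *
      (E (x * y * q ^ (I + 1) * q ^ m) p * E (x * q ^ (I + 2) / y * q ^ m) p *
        E (1 / q ^ (2 * I + 1) * q ^ m) p /
      (E (x ^ 2 * q * q ^ 2 / (x * y * q ^ (I + 1)) * (q ^ 2) ^ m) p *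
        E (x ^ 2 * q * q ^ 2 / (x * q ^ (I + 2) / y) * (q ^ 2) ^ m) p *
        E (x ^ 2 * q * q ^ 2 / (1 / q ^ (2 * I + 1)) * (q ^ 2) ^ m) p)) := by
  have hq := hg.q0
  have hx := hg.x0
  have hy := hg.y0
  have hd : (I : ℤ) + 1 - ((m : ℤ) + 1) = (I : ℤ) - m - 1 + 1 := by ring
  have hd' : (I : ℤ) + 1 - ((m : ℤ) + 1 + 1) = (I : ℤ) - m - 1 := by ring
  have u1 : q ^ (2 - 2 * ((I : ℤ) + 1)) / (x * y) * q ^ ((I : ℤ) - m - 1) =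
      (x * y * q ^ (I + 1) * q ^ m)⁻¹ := by
    refine eq_inv_of_mul_eq_one_left ?_
    simp only [← zpow_natCast]
    field_simp
    simp only [← zpow_add₀ hq]
    push_cast
    ring_nf
    simp
  have u2 : y * q ^ (1 - 2 * ((I : ℤ) + 1)) / x * q ^ ((I : ℤ) - m - 1) =
      (x * q ^ (I + 2) / y * q ^ m)⁻¹ := by
    refine eq_inv_of_mul_eq_one_left ?_
    simp only [← zpow_natCast]
    field_simp
    simp only [← zpow_add₀ hq]
    push_cast
    ring_nf
    simp
  have u3 : q ^ ((I : ℤ) + 1 + 1) * q ^ ((I : ℤ) - m - 1) =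
      (1 / q ^ (2 * I + 1) * q ^ m)⁻¹ := by
    refine eq_inv_of_mul_eq_one_left ?_
    simp only [← zpow_natCast]
    field_simp
    simp only [← zpow_add₀ hq]
    push_cast
    ring_nf
  have v1 : y * q ^ (1 - ((I : ℤ) + 1)) / x * (q ^ 2) ^ ((I : ℤ) - m - 1) =
      (x ^ 2 * q * q ^ 2 / (x * y * q ^ (I + 1)) * (q ^ 2) ^ m)⁻¹ := by
    refine eq_inv_of_mul_eq_one_left ?_
    simp only [← zpow_natCast, ← zpow_mul]
    field_simp
    simp only [← zpow_add₀ hq]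
    push_cast
    ring_nf
    simp only [zpow_sub₀ hq, zpow_add₀ hq, zpow_neg, zpow_mul, zpow_natCast, zpow_ofNat]
    field_simp
  have v2 : q ^ (2 - ((I : ℤ) + 1)) / (x * y) * (q ^ 2) ^ ((I : ℤ) - m - 1) =
      (x ^ 2 * q * q ^ 2 / (x * q ^ (I + 2) / y) * (q ^ 2) ^ m)⁻¹ := by
    refine eq_inv_of_mul_eq_one_left ?_
    simp only [← zpow_natCast, ← zpow_mul]
    field_simp
    simp only [← zpow_add₀ hq]
    push_cast
    ring_nf
    simp only [zpow_sub₀ hq, zpow_add₀ hq, zpow_neg, zpow_mul, zpow_natCast, zpow_ofNat]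
    field_simp
  have v3 : q ^ (2 - 4 * ((I : ℤ) + 1)) / x ^ 2 * (q ^ 2) ^ ((I : ℤ) - m - 1) =
      (x ^ 2 * q * q ^ 2 / (1 / q ^ (2 * I + 1)) * (q ^ 2) ^ m)⁻¹ := by
    refine eq_inv_of_mul_eq_one_left ?_
    simp only [← zpow_natCast, ← zpow_mul]
    field_simp
    simp only [← zpow_add₀ hq]
    push_cast
    ring_nf
    simp only [zpow_sub₀ hq, zpow_add₀ hq, zpow_neg, zpow_mul, zpow_natCast, zpow_ofNat]
    field_simp
  have hQ := quadGeneric hg I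
  have nv1 := hQ.divA (2 * m + 2)
  have nv2 := hQ.divB (2 * m + 2)
  have nv3 := hQ.divC (2 * m + 2)
  have nu1 := hg.ne_zero (I + 1 + m) 1 1 (by simp)
  have nu2 := hg.ne_zero (I + 2 + m) 1 (-1) (by simp)
  -- The argument equals 1 when m = 2I + 1, so nonvanishing is claimed only for nonnegative
  -- subscripts, where the exponent is negative.
  have nu3 (h : 0 ≤ (I : ℤ) - m - 1) := hg.ne_zero (m - (2 * I + 1)) 0 0 (by left; omega)
  rw [show x ^ 2 * q * q ^ (2 * m + 2) / (x * y * q ^ (I + 1)) =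
    x ^ 2 * q * q ^ 2 / (x * y * q ^ (I + 1)) * (q ^ 2) ^ m by rw [pow_add, pow_mul]; ring] at nv1
  rw [show x ^ 2 * q * q ^ (2 * m + 2) / (x * q ^ (I + 2) / y) =
    x ^ 2 * q * q ^ 2 / (x * q ^ (I + 2) / y) * (q ^ 2) ^ m by rw [pow_add, pow_mul]; ring] at nv2
  rw [show x ^ 2 * q * q ^ (2 * m + 2) / (1 / q ^ (2 * I + 1)) =
    x ^ 2 * q * q ^ 2 / (1 / q ^ (2 * I + 1)) * (q ^ 2) ^ m by rw [pow_add, pow_mul]; ring] at nv3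
  rw [show q ^ ((I : ℤ) + 1 + m) * x ^ (1 : ℤ) * y ^ (1 : ℤ) = x * y * q ^ (I + 1) * q ^ m by
    rw [show (I : ℤ) + 1 + m = (I + 1 + m : ℕ) by push_cast; ring, zpow_natCast, pow_add]
    simp only [zpow_one]; ring] at nu1
  rw [show q ^ ((I : ℤ) + 2 + m) * x ^ (1 : ℤ) * y ^ (-1 : ℤ) = x * q ^ (I + 2) / y * q ^ m by
    rw [show (I : ℤ) + 2 + m = (I + 2 + m : ℕ) by push_cast; ring, zpow_natCast, pow_add]
    simp only [zpow_one, zpow_neg]; ring] at nu2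
  rw [show q ^ ((m : ℤ) - (2 * I + 1)) * x ^ (0 : ℤ) * y ^ (0 : ℤ) = 1 / q ^ (2 * I + 1) * q ^ m by
    rw [zpow_sub₀ hq, zpow_natCast, show (2 * (I : ℤ) + 1) = (2 * I + 1 : ℕ) by push_cast; ring,
      zpow_natCast]
    simp only [zpow_zero]; ring] at nu3
  have hUV : (x ^ 2 * q * q ^ 2 / (x * y * q ^ (I + 1)) * (q ^ 2) ^ m) *
      (x ^ 2 * q * q ^ 2 / (x * q ^ (I + 2) / y) * (q ^ 2) ^ m) *
      (x ^ 2 * q * q ^ 2 / (1 / q ^ (2 * I + 1)) * (q ^ 2) ^ m) =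
      (x ^ 2 * q * q ^ (4 + 3 * m)) * ((x * y * q ^ (I + 1) * q ^ m) *
      (x * q ^ (I + 2) / y * q ^ m) * (1 / q ^ (2 * I + 1) * q ^ m)) := by
    field_simp
    ring
  have zu1 : x * y * q ^ (I + 1) * q ^ m ≠ 0 := by positivity
  have zu2 : x * q ^ (I + 2) / y * q ^ m ≠ 0 := by positivity
  have zu3 : 1 / q ^ (2 * I + 1) * q ^ m ≠ 0 :=
    mul_ne_zero (one_div_ne_zero (pow_ne_zero _ hq)) (pow_ne_zero _ hq)
  have zv1 : x ^ 2 * q * q ^ 2 / (x * y * q ^ (I + 1)) * (q ^ 2) ^ m ≠ 0 := by positivity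
  have zv2 : x ^ 2 * q * q ^ 2 / (x * q ^ (I + 2) / y) * (q ^ 2) ^ m ≠ 0 := by positivity
  have zv3 : x ^ 2 * q * q ^ 2 / (1 / q ^ (2 * I + 1)) * (q ^ 2) ^ m ≠ 0 := by
    rw [div_div_eq_mul_div, div_one]; positivity
  have key {w b U : ℂ} (d : ℤ) (h : w * b ^ d = U⁻¹) (hU : U ≠ 0) (hE : 0 ≤ d → E U p ≠ 0) :
      ellPoch w b p d = ellPoch w b p (d + 1) * (-E U p / U)⁻¹ := by
    rw [← E_inv hp hU, ← h]
    refine ellPoch_pred fun hd => ?_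
    rw [h, E_inv hp hU]
    exact div_ne_zero (neg_ne_zero.2 (hE hd)) hU
  simp only [entry, ellPochs, List.map, List.prod_cons, List.prod_nil, mul_one]
  rw [hd, hd', key _ u1 zu1 fun _ => nu1, key _ u2 zu2 fun _ => nu2, key _ u3 zu3 nu3,
    key _ v1 zv1 fun _ => nv1, key _ v2 zv2 fun _ => nv2, key _ v3 zv3 fun _ => nv3]
  clear key nv1 nv2 nv3 nu1 nu2 nu3 u1 u2 u3 v1 v2 v3 hd hd' hQ
  generalize x * y * q ^ (I + 1) * q ^ m = U1 at *
  generalize x * q ^ (I + 2) / y * q ^ m = U2 at *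
  generalize 1 / q ^ (2 * I + 1) * q ^ m = U3 at *
  generalize x ^ 2 * q * q ^ 2 / (x * y * q ^ (I + 1)) * (q ^ 2) ^ m = V1 at *
  generalize x ^ 2 * q * q ^ 2 / (x * q ^ (I + 2) / y) * (q ^ 2) ^ m = V2 at *
  generalize x ^ 2 * q * q ^ 2 / (1 / q ^ (2 * I + 1)) * (q ^ 2) ^ m = V3 at *
  generalize x ^ 2 * q * q ^ (4 + 3 * m) = w at *
  simp only [div_eq_mul_inv, mul_inv, inv_inv, inv_neg, mul_neg, neg_mul, neg_neg]
  rw [show w = V1 * V2 * V3 * (U1⁻¹ * U2⁻¹ * U3⁻¹) by rw [hUV]; field_simp]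
  ring

end Entries

/-! ### The diagonal value of the sum. -/

section Factor

variable {e : ℂ → ℂ} {a q A B C t : ℂ}

/-- One factor of the determinant evaluation. -/
noncomputable def detFactor (e : ℂ → ℂ) (q A B t : ℂ) (n : ℕ) : ℂ :=
  shifted e q q n * shifted e t q n / (shifted e q (q ^ 2) n * shifted e t (q ^ 2) n) *
    (shifted e A (q ^ 2) n * shifted e B (q ^ 2) n / (shifted e A q n * shifted e B q n))

/-- At C = q^(-(2N+1)) the closed form is a factor of the determinant times the last summand m = N.
The products on both sides differ by end factors only, after inversion in (1/Q; q)_N with Q =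
q^(2N+1). -/
lemma quadValue_eq (h : IsTheta e) (N : ℕ)
    (hg : QuadGeneric e (t * q) q (A * q) (B * q) (1 / q ^ (2 * N + 1)))
    (hA : ∀ k : ℕ, e (A * q ^ k) ≠ 0) (hB : ∀ k : ℕ, e (B * q ^ k) ≠ 0)
    (ht : ∀ k : ℕ, e (t * q ^ k) ≠ 0) :
    quadValue e (t * q) q (A * q) (B * q) (1 / q ^ (2 * N + 1)) N =
      detFactor e q A B (t * q ^ (2 * N)) (N + 1) *
      paramPart e (t * q) q (A * q) (B * q) (1 / q ^ (2 * N + 1)) N *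
      terminatingPart e (t * q) q (q ^ (2 * N + 1)) N := by
  have hq := hg.q0
  have shift {z : ℂ} (hz : ∀ k : ℕ, e (z * q ^ k) ≠ 0) (j l n : ℕ) :
      shifted e (z * q ^ j) (q ^ l) n ≠ 0 := shifted_ne_zero fun k _ => by
    rw [mul_assoc, ← pow_mul, ← pow_add]; exact hz _
  have hA0 : e A ≠ 0 := by simpa using hA 0
  have hB0 : e B ≠ 0 := by simpa using hB 0
  have hA1 : shifted e (A * q) q N ≠ 0 := by simpa using shift hA 1 1 N
  have hB1 : shifted e (B * q) q N ≠ 0 := by simpa using shift hB 1 1 N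
  have ht0 := ht (2 * N)
  have ht1 : e (t * q) ≠ 0 := by simpa using ht 1
  have ht2 := ht (1 + 3 * N)
  have hs1 : shifted e (t * q * q ^ (2 * N + 1)) q N ≠ 0 := by
    rw [mul_assoc, ← pow_succ']; simpa using shift ht (2 * N + 2) 1 N
  have hs2 : shifted e (t * q * q ^ (2 * N + 1)) (q ^ 2) N ≠ 0 := by
    rw [mul_assoc, ← pow_succ']; simpa using shift ht (2 * N + 2) 2 N
  have hQ : e (q ^ (2 * N + 1)) ≠ 0 := hg.base_nat _
  have hN : e (q ^ (N + 1)) ≠ 0 := hg.base_nat _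
  have hq1 : shifted e q q N ≠ 0 := shifted_ne_zero fun k _ => by
    rw [← pow_succ']; exact hg.base_nat _
  have hq2 : shifted e q (q ^ 2) N ≠ 0 := shifted_ne_zero fun k _ => by
    rw [← pow_mul, ← pow_succ']; exact hg.base_nat _
  have hd := hg.shifted_base N le_rfl
  have s1 : shifted e (t * q ^ (2 * N)) q (N + 1) * e (t * q ^ (1 + 3 * N)) =
      e (t * q ^ (2 * N)) * (e (t * q ^ (2 * N + 1)) * shifted e (t * q * q ^ (2 * N + 1)) q N) := by
    rw [shifted_succ', mul_assoc]
    congr 1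
    rw [show t * q ^ (1 + 3 * N) = t * q ^ (2 * N) * q * q ^ N by ring, ← shifted_succ,
      shifted_succ']
    ring_nf
  have s2 : shifted e (t * q ^ (2 * N)) (q ^ 2) (N + 1) =
      e (t * q ^ (2 * N)) * shifted e (t * q * q ^ (2 * N + 1)) (q ^ 2) N := by
    rw [shifted_succ']
    ring_nf
  have s3 : e (t * q) * shifted e (t * q * q ^ 2) (q ^ 2) N =
      shifted e (t * q) (q ^ 2) N * e (t * q ^ (2 * N + 1)) := by
    rw [← shifted_succ', shifted_succ]
    ring_nf
  have s4 : shifted e (1 / q ^ (2 * N + 1)) q N * e (q ^ (N + 1)) * q ^ N =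
      e (q ^ (2 * N + 1)) * shifted e (q / q ^ (2 * N + 1)) q N := by
    have := (shifted_succ e (1 / q ^ (2 * N + 1)) q N).symm.trans (shifted_succ' ..)
    rw [show 1 / q ^ (2 * N + 1) * q ^ N = (q ^ (N + 1))⁻¹ by field_simp; ring,
      h.inv (pow_ne_zero _ hq), one_div_mul_eq_div, one_div, h.inv (pow_ne_zero _ hq)] at this
    field_simp at this
    refine mul_left_cancel₀ (pow_ne_zero (N + 1) hq) ?_
    linear_combination -this
  have s5 : shifted e q q (N + 1) = shifted e q q N * e (q ^ (N + 1)) := by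
    rw [shifted_succ, pow_succ']
  have s6 : shifted e q (q ^ 2) (N + 1) = shifted e q (q ^ 2) N * e (q ^ (2 * N + 1)) := by
    rw [shifted_succ, ← pow_mul, pow_succ' q (2 * N)]
  have s7 : terminatingPart e (t * q) q (q ^ (2 * N + 1)) N =
    q ^ N * e (t * q ^ (1 + 3 * N)) / e (t * q) *
    (shifted e (t * q) (q ^ 2) N * shifted e (t * q * q ^ (2 * N + 1)) (q ^ 2) N * shifted e (q / q ^ (2 * N + 1)) (q ^ 2) N /
      (shifted e q q N * shifted e (t * q * q ^ (2 * N + 1)) q N * shifted e (q / q ^ (2 * N + 1)) q N)) := by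
    rw [terminatingPart, pow_add q 1, pow_one, mul_assoc t q (q ^ (3 * N))]
  rw [detFactor, s5, s6, s2, shifted_succ' e A, shifted_succ' e B, shifted_succ' e A,
    shifted_succ' e B, s7, quadValue, paramPart, one_div_mul_eq_div]
  clear shift s5 s6 s2 s7 hg hA hB ht
  rw [mul_assoc A, mul_assoc B, ← pow_two q]
  have hN0 := pow_ne_zero N hq
  generalize shifted e (t * q ^ (2 * N)) q (N + 1) = z0 at *
  generalize shifted e (t * q * q ^ 2 / (A * q)) (q ^ 2) N * shifted e (t * q * q ^ 2 / (B * q)) (q ^ 2) N *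
    shifted e (t * q * q ^ 2 / (1 / q ^ (2 * N + 1))) (q ^ 2) N = z1 at *
  generalize shifted e (t * q * q ^ 2) (q ^ 2) N = z2 at *
  generalize shifted e (t * q * q ^ (2 * N + 1)) (q ^ 2) N = z3 at *
  generalize shifted e (t * q * q ^ (2 * N + 1)) q N = z4 at *
  generalize shifted e (t * q) (q ^ 2) N = z5 at *
  generalize shifted e (q / q ^ (2 * N + 1)) q N = z6 at *
  generalize shifted e (q / q ^ (2 * N + 1)) (q ^ 2) N = z7 at *
  generalize shifted e (1 / q ^ (2 * N + 1)) q N = z8 at *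
  generalize shifted e q (q ^ 2) N = z9 at *
  generalize shifted e q q N = z10 at *
  generalize shifted e (A * q) q N = z11 at *
  generalize shifted e (B * q) q N = z12 at *
  generalize shifted e (A * q ^ 2) (q ^ 2) N = z13 at *
  generalize shifted e (B * q ^ 2) (q ^ 2) N = z14 at *
  generalize e A = z15 at *
  generalize e B = z16 at *
  generalize e (q ^ (N + 1)) = z17 at *
  generalize e (q ^ (2 * N + 1)) = z18 at *
  generalize e (t * q ^ (2 * N)) = z19 at *
  generalize e (t * q ^ (2 * N + 1)) = z20 at *
  generalize e (t * q ^ (1 + 3 * N)) = z21 at *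
  generalize e (t * q) = z22 at *
  generalize q ^ N = r at *
  clear h hq
  rw [← eq_div_iff ht2] at s1
  rw [mul_assoc, ← eq_div_iff (mul_ne_zero hN hN0)] at s4
  rw [mul_comm, ← eq_div_iff ht1] at s3
  subst s1 s3 s4
  -- Both sides carry the denominator z1, so its vanishing makes both zero.
  rcases eq_or_ne z1 0 with rfl | hz1
  · simp
  · field_simp

end Factor

/-! ### Triangular factorization and the generic determinant. -/

/-- If `V` is upper triangular with nonzero diagonal and `M * V` is lower triangular, then the
determinant of `M` is the product of the quotients of the diagonal entries. -/
lemma det_eq_prod_of_mul_triangular {n : ℕ} {M V : Matrix (Fin n) (Fin n) ℂ} {f : Fin n → ℂ}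
    (hV : ∀ i j, j < i → V i j = 0) (hV0 : ∀ i, V i i ≠ 0)
    (hMV : ∀ i j, i < j → (M * V) i j = 0) (hf : ∀ i, (M * V) i i = f i * V i i) :
    M.det = ∏ i, f i := by
  have h1 : V.det = ∏ i, V i i := Matrix.det_of_isUpperTriangular fun i j h => hV i j h
  have h2 : (M * V).det = ∏ i, (M * V) i i :=
    Matrix.det_of_isLowerTriangular _ fun i j h => hMV i j h
  rw [Matrix.det_mul, h1, Finset.prod_congr rfl fun i _ => hf i, Finset.prod_mul_distrib] at h2
  exact mul_right_cancel₀ (Finset.prod_ne_zero_iff.2 fun i _ => hV0 i) h2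

section Determinant

variable {p q x y : ℂ}

/-- The part of the entries depending on the column only. -/
noncomputable def columnWeight (x q : ℂ) (m : ℕ) : ℂ :=
  ∏ l ∈ Finset.range m, (x ^ 2 * q * q ^ (4 + 3 * l))

lemma entry_eq_mul_paramPart (hp : ‖p‖ < 1) (hg : Generic p q x y) (I m : ℕ) :
    entry x y q p ((I : ℤ) + 1) ((m : ℤ) + 1) = entry x y q p ((I : ℤ) + 1) 1 *
      columnWeight x q m * paramPart (fun z => E z p) (x ^ 2 * q) q (x * y * q ^ (I + 1))
        (x * q ^ (I + 2) / y) (1 / q ^ (2 * I + 1)) m := by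
  induction m with
  | zero => simp [columnWeight, paramPart]
  | succ m ih =>
    rw [Nat.cast_add, Nat.cast_one, entry_succ_right hp hg, ih, columnWeight, columnWeight,
      Finset.prod_range_succ, paramPart, paramPart]
    simp only [shifted_succ]
    ring

/-- With C = q^(-(2I+1)), the factor k = I of (Cq; q²)_N is e(1), and it is present because I < N.
-/
lemma quadValue_eq_zero (e : ℂ → ℂ) (he : e 1 = 0) {a q A B : ℂ} (hq : q ≠ 0) {I N : ℕ}
    (h : I < N) : quadValue e a q A B (1 / q ^ (2 * I + 1)) N = 0 := by
  rw [quadValue, shifted_eq_zero (z := 1 / q ^ (2 * I + 1) * q) h]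
  · simp
  · rw [← he]
    congr 1
    field_simp
    ring

lemma terminatingPart_ne_zero {e : ℂ → ℂ} {a q A B C : ℂ} (hg : QuadGeneric e a q A B C) (N : ℕ) :
    terminatingPart e a q (q ^ (2 * N + 1)) N ≠ 0 := by
  have ha : e a ≠ 0 := by simpa using hg.param 0
  have h1 : shifted e a (q ^ 2) N ≠ 0 := shifted_ne_zero fun k _ => by
    rw [← pow_mul]; exact hg.param _
  have h2 : shifted e (a * q ^ (2 * N + 1)) (q ^ 2) N ≠ 0 := shifted_ne_zero fun k _ => by
    rw [← pow_mul, mul_assoc, ← pow_add]; exact hg.param _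
  have h3 : shifted e (q / q ^ (2 * N + 1)) (q ^ 2) N ≠ 0 := shifted_ne_zero fun k hk => by
    have := hg.base_div (m := 2 * k + 1) (n := 2 * N + 1) (by omega)
    rwa [pow_succ', mul_div_right_comm, pow_mul] at this
  have h4 : shifted e q q N ≠ 0 := shifted_ne_zero fun k _ => by
    rw [← pow_succ']; exact hg.base_nat _
  have h5 := hg.param (3 * N)
  exact mul_ne_zero (div_ne_zero (mul_ne_zero (pow_ne_zero _ hg.q0) h5) ha)
    (div_ne_zero (mul_ne_zero (mul_ne_zero h1 h2) h3)
      (mul_ne_zero (mul_ne_zero h4 (hg.shifted_param _ _)) (hg.shifted_base N le_rfl)))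

theorem Generic.det_eq (hp : ‖p‖ < 1) (hg : Generic p q x y) (n : ℕ) :
    (Matrix.of fun i j : Fin n =>
      entry x y q p ((i : ℕ) + 1 : ℤ) ((j : ℕ) + 1 : ℤ)).det =
    ∏ i : Fin n, detFactor (fun z => E z p) q (x * y * q ^ (i : ℕ)) (x * q ^ ((i : ℕ) + 1) / y)
      (x ^ 2 * q ^ (2 * (i : ℕ))) ((i : ℕ) + 1) := by
  have hq := hg.q0
  have hw (m : ℕ) : columnWeight x q m ≠ 0 := Finset.prod_ne_zero_iff.2 fun l _ =>
    mul_ne_zero (mul_ne_zero (pow_ne_zero _ hg.x0) hq) (pow_ne_zero _ hq)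
  -- Column j carries the sum with N = j; dividing by the column weight leaves exactly the summand
  -- in M V.
  set V : Matrix (Fin n) (Fin n) ℂ := Matrix.of fun i j =>
    if (i : ℕ) ≤ j then terminatingPart (fun z => E z p) (x ^ 2 * q) q (q ^ (2 * (j : ℕ) + 1)) i /
      columnWeight x q i else 0 with hV
  have hMV (i j : Fin n) : ((Matrix.of fun i j : Fin n =>
      entry x y q p ((i : ℕ) + 1 : ℤ) ((j : ℕ) + 1 : ℤ)) * V) i j =
      entry x y q p ((i : ℕ) + 1 : ℤ) 1 * quadValue (fun z => E z p) (x ^ 2 * q) q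
        (x * y * q ^ ((i : ℕ) + 1)) (x * q ^ ((i : ℕ) + 2) / y) (1 / q ^ (2 * (i : ℕ) + 1)) j := by
    rw [← (quadGeneric hg i).sum_eq_quadValue j (isTheta_E hp), Finset.mul_sum, Matrix.mul_apply]
    have hs : Finset.range ((j : ℕ) + 1) = (Finset.range n).filter (· ≤ (j : ℕ)) := by
      ext k
      have := j.2
      simp only [Finset.mem_range, Finset.mem_filter]
      omega
    rw [hs, Finset.sum_filter, ← Fin.sum_univ_eq_sum_range (fun m => if m ≤ (j : ℕ) then _ else 0)]
    refine Finset.sum_congr rfl fun k _ => ?_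
    simp only [hV, Matrix.of_apply, mul_ite, mul_zero]
    split_ifs
    · rw [entry_eq_mul_paramPart hp hg]
      have := hw k
      field_simp
    · rfl
  refine det_eq_prod_of_mul_triangular (V := V) (fun i j h => ?_) (fun i => ?_)
    (fun i j h => ?_) (fun i => ?_)
  · simp only [hV, Matrix.of_apply]
    exact if_neg (not_le.2 h)
  · simp only [hV, Matrix.of_apply, le_refl, if_true]
    exact div_ne_zero (terminatingPart_ne_zero (quadGeneric hg i) i) (hw i)
  · rw [hMV, quadValue_eq_zero _ (isTheta_E hp).one hq h, mul_zero]
  · have h1 := entry_eq_mul_paramPart hp hg i i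
    have hQ := quadGeneric hg i
    have hA : x * y * q ^ ((i : ℕ) + 1) = x * y * q ^ (i : ℕ) * q := by ring
    have hB : x * q ^ ((i : ℕ) + 2) / y = x * q ^ ((i : ℕ) + 1) / y * q := by ring
    -- The unit diagonal of M turns the row factor, column weight and `paramPart` into a product
    -- equal to 1.
    rw [entry_self] at h1
    rw [hMV]
    rw [hA, hB] at h1 hQ ⊢
    rw [quadValue_eq (isTheta_E hp) _ hQ]
    · simp only [hV, Matrix.of_apply, le_refl, if_true]
      have := hw i
      rw [mul_div_assoc', eq_div_iff this]
      linear_combination -(detFactor (fun z => E z p) q (x * y * q ^ (i : ℕ))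
        (x * q ^ ((i : ℕ) + 1) / y) (x ^ 2 * q ^ (2 * (i : ℕ))) ((i : ℕ) + 1)) *
        terminatingPart (fun z => E z p) (x ^ 2 * q) q (q ^ (2 * (i : ℕ) + 1)) i * h1
    · intro k
      convert hg.ne_zero (i + k) 1 1 (by simp) using 2
      rw [zpow_add₀ hq, zpow_natCast, zpow_natCast, zpow_one, zpow_one]
      ring
    · intro k
      convert hg.ne_zero (i + 1 + k) 1 (-1) (by simp) using 2
      rw [zpow_add₀ hq, zpow_add₀ hq, zpow_natCast, zpow_natCast, zpow_one, zpow_one, zpow_neg_one]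
      ring
    · intro k
      convert hg.ne_zero k 2 0 (by simp) using 2
      rw [zpow_natCast, zpow_zero]
      norm_cast
      ring

end Determinant

/-! ### Density of generic parameters. -/

lemma dense_of_dense_fibers {X Y : Type*} [TopologicalSpace X] [TopologicalSpace Y] {A : Set X}
    {B : X → Set Y} (hA : Dense A) (hB : ∀ a ∈ A, Dense (B a)) :
    Dense {z : X × Y | z.1 ∈ A ∧ z.2 ∈ B z.1} := by
  rw [dense_iff_inter_open]
  rintro O hO ⟨⟨u, v⟩, huv⟩
  obtain ⟨U, V, hU, hV, hu, hv, hUV⟩ := isOpen_prod_iff.1 hO u v huv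
  obtain ⟨a, haU, haA⟩ := hA.inter_open_nonempty U hU ⟨u, hu⟩
  obtain ⟨b, hbV, hbB⟩ := (hB a haA).inter_open_nonempty V hV ⟨v, hv⟩
  exact ⟨(a, b), hUV ⟨haU, hbV⟩, haA, hbB⟩

lemma finite_zpow_eq {c : ℤ} (hc : c ≠ 0) (w : ℂ) : {z : ℂ | z ^ c = w}.Finite := by
  have pos {n : ℕ} (hn : 0 < n) (w : ℂ) : {z : ℂ | z ^ n = w}.Finite := by
    refine (Polynomial.nthRoots n w).toFinset.finite_toSet.subset fun z hz => ?_
    simpa [Polynomial.mem_nthRoots hn] using hz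
  obtain ⟨n, rfl | rfl⟩ := c.eq_nat_or_neg
  · simpa using pos (n := n) (by omega) w
  · refine (pos (n := n) (by omega) w⁻¹).subset fun z hz => ?_
    have hz : z ^ (-(n : ℤ)) = w := hz
    rw [← hz]
    simp

/-- For each index, exponent and zero of `E` only finitely many z are excluded, hence countably many
in total. -/
lemma dense_ne_zero {p : ℂ} (hp : ‖p‖ < 1) {ι : Type*} [Countable ι] {k : ι → ℂ}
    (hk : ∀ i, k i ≠ 0) :
    Dense {z : ℂ | z ≠ 0 ∧ ∀ i, ∀ c : ℤ, c ≠ 0 → E (k i * z ^ c) p ≠ 0} := by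
  have h : ({0} ∪ ⋃ i, ⋃ c : {c : ℤ // c ≠ 0}, ⋃ w ∈ {w : ℂ | E w p = 0},
      {z : ℂ | z ^ (c : ℤ) = w / k i}).Countable := by
    refine (Set.countable_singleton 0).union (Set.countable_iUnion fun i =>
      Set.countable_iUnion fun c => (countable_zeros_E hp).biUnion fun w _ => ?_)
    exact (finite_zpow_eq c.2 _).countable
  refine (h.dense_compl ℂ).mono fun z hz => ?_
  simp only [Set.mem_compl_iff, Set.mem_union, Set.mem_iUnion, not_or, not_exists] at hz
  refine ⟨hz.1, fun i c hc h0 => hz.2 i ⟨c, hc⟩ _ h0 ?_⟩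
  exact (mul_div_cancel_left₀ _ (hk i)).symm

lemma dense_generic {p : ℂ} (hp : ‖p‖ < 1) :
    Dense {z : ℂ × ℂ × ℂ | Generic p z.1 z.2.1 z.2.2} := by
  let Y (q x : ℂ) : Set ℂ :=
    {y | y ≠ 0 ∧ ∀ i : ℤ × ℤ, ∀ c : ℤ, c ≠ 0 → E (q ^ i.1 * x ^ i.2 * y ^ c) p ≠ 0}
  let X (q : ℂ) : Set ℂ := {x | x ≠ 0 ∧ ∀ a : ℤ, ∀ c : ℤ, c ≠ 0 → E (q ^ a * x ^ c) p ≠ 0}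
  have hX (q : ℂ) (hq : q ≠ 0) : Dense {w : ℂ × ℂ | w.1 ∈ X q ∧ w.2 ∈ Y q w.1} :=
    dense_of_dense_fibers (dense_ne_zero hp fun a => zpow_ne_zero a hq) fun x hx =>
      dense_ne_zero hp fun i : ℤ × ℤ => mul_ne_zero (zpow_ne_zero i.1 hq) (zpow_ne_zero i.2 hx.1)
  have h := dense_of_dense_fibers (dense_ne_zero hp (k := fun _ : Unit => 1) fun _ => one_ne_zero)
    fun q hq => hX q hq.1
  refine h.mono ?_
  · rintro ⟨q, x, y⟩ ⟨hq, hx, hy⟩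
    refine ⟨hq.1, hx.1, hy.1, fun a b c h => ?_⟩
    -- The variables are chosen in the order q, x, y, so the last one with nonzero exponent excludes
    -- the monomial.
    by_cases hc : c = 0
    · by_cases hb : b = 0
      · subst hb hc
        simpa using hq.2 () a (by simpa using h)
      · subst hc
        simpa using hx.2 a b hb
    · exact hy.2 (a, b) c hc

/-! ### Continuity of elliptic shifted factorials. -/

section Continuity

variable {X : Type*} [TopologicalSpace X] {f b : X → ℂ} {z₀ : X} {p : ℂ}

lemma continuousAt_ellPoch (hp : ‖p‖ < 1) (hf : ContinuousAt f z₀) (hb : ContinuousAt b z₀)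
    (hf0 : f z₀ ≠ 0) (hb0 : b z₀ ≠ 0) {m : ℤ} (hm : m < 0 → ellPoch (f z₀) (b z₀) p m ≠ 0) :
    ContinuousAt (fun z => ellPoch (f z) (b z) p m) z₀ := by
  have key (k : ℤ) : ContinuousAt (fun z => E (f z * b z ^ k) p) z₀ :=
    (continuousAt_E hp (mul_ne_zero hf0 (zpow_ne_zero k hb0))).comp
      (f := fun z => f z * b z ^ k) (hf.mul (hb.zpow₀ k (Or.inl hb0)))
  by_cases h : 0 ≤ m
  · simp only [ellPoch, if_pos h]
    exact tendsto_finsetProd _ fun k _ => by simpa using (key k).tendsto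
  · have hm := hm (not_le.1 h)
    simp only [ellPoch, if_neg h, one_div] at hm ⊢
    exact ContinuousAt.inv₀ (tendsto_finsetProd _ fun k _ => key _) fun h0 => hm (by rw [h0, inv_zero])

/-- For m < 0 the inverse is a finite product of theta functions, continuous even where it vanishes.
This is what makes the zeros of 1/(q^(i+1); q, p)_(i-j) harmless in the limit. -/
lemma continuousAt_ellPoch_inv (hp : ‖p‖ < 1) (hf : ContinuousAt f z₀) (hb : ContinuousAt b z₀)
    (hf0 : f z₀ ≠ 0) (hb0 : b z₀ ≠ 0) {m : ℤ} (hm : 0 ≤ m → ellPoch (f z₀) (b z₀) p m ≠ 0) :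
    ContinuousAt (fun z => (ellPoch (f z) (b z) p m)⁻¹) z₀ := by
  by_cases h : 0 ≤ m
  · exact (continuousAt_ellPoch hp hf hb hf0 hb0 fun h' => absurd h (not_le.2 h')).inv₀ (hm h)
  · have key (k : ℤ) : ContinuousAt (fun z => E (f z * b z ^ k) p) z₀ :=
      (continuousAt_E hp (mul_ne_zero hf0 (zpow_ne_zero k hb0))).comp
        (f := fun z => f z * b z ^ k) (hf.mul (hb.zpow₀ k (Or.inl hb0)))
    simp only [ellPoch, if_neg h, one_div, inv_inv]
    exact tendsto_finsetProd _ fun k _ => key _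

lemma ellPoch_neg {a b : ℂ} (hb : b ≠ 0) {m : ℤ} (hm : m < 0) :
    ellPoch a b p m = (ellPoch (a * b ^ m) b p (-m))⁻¹ := by
  rw [ellPoch, if_neg (not_le.2 hm), ellPoch, if_pos (by omega), one_div]
  congr 1
  refine Finset.prod_congr rfl fun k _ => ?_
  rw [mul_assoc, zpow_add₀ hb, zpow_natCast]

end Continuity

lemma ellPochs_pair (a₁ a₂ b p : ℂ) (m : ℤ) :
    ellPochs [a₁, a₂] b p m = ellPoch a₁ b p m * ellPoch a₂ b p m := by
  simp [ellPochs]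

lemma ellPochs_triple (a₁ a₂ a₃ b p : ℂ) (m : ℤ) : ellPochs [a₁, a₂, a₃] b p m =
    ellPoch a₁ b p m * (ellPoch a₂ b p m * ellPoch a₃ b p m) := by
  simp [ellPochs]

/-! ### Passage from generic to arbitrary parameters. -/

section Limit

variable {n : ℕ} {p q x y : ℂ}

lemma EntriesDefined.continuousAt_entry (hp : ‖p‖ < 1) (hq : q ≠ 0) (hx : x ≠ 0) (hy : y ≠ 0)
    (hM : EntriesDefined n x y q p) (i j : Fin n) :
    ContinuousAt (fun z : ℂ × ℂ × ℂ =>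
      entry z.2.1 z.2.2 z.1 p ((i : ℕ) + 1 : ℤ) ((j : ℕ) + 1 : ℤ)) (q, x, y) := by
  have hi := i.2
  have hj := j.2
  rcases eq_or_ne i j with rfl | hij
  · simp only [entry_self]
    exact continuousAt_const
  have hij' : (i : ℕ) ≠ j := fun h => hij (Fin.ext h)
  generalize hI : ((i : ℕ) + 1 : ℤ) = I
  generalize hJ : ((j : ℕ) + 1 : ℤ) = J
  have cq : ContinuousAt (fun z : ℂ × ℂ × ℂ => z.1) (q, x, y) := continuousAt_fst
  have cx : ContinuousAt (fun z : ℂ × ℂ × ℂ => z.2.1) (q, x, y) := by fun_prop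
  have cy : ContinuousAt (fun z : ℂ × ℂ × ℂ => z.2.2) (q, x, y) := by fun_prop
  have cz (k : ℤ) : ContinuousAt (fun z : ℂ × ℂ × ℂ => z.1 ^ k) (q, x, y) :=
    cq.zpow₀ k (Or.inl hq)
  have hxy : x * y ≠ 0 := mul_ne_zero hx hy
  have hx2 : x ^ 2 ≠ 0 := pow_ne_zero 2 hx
  have hq2 : q ^ 2 ≠ 0 := pow_ne_zero 2 hq
  have num : I - J < 0 → ellPoch (y * q ^ (1 - I) / x) (q ^ 2) p (I - J) ≠ 0 ∧
      ellPoch (q ^ (2 - I) / (x * y)) (q ^ 2) p (I - J) ≠ 0 ∧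
      ellPoch (q ^ (2 - 4 * I) / x ^ 2) (q ^ 2) p (I - J) ≠ 0 := by
    intro h
    have := hM.2 I J (by omega) (by omega) (by omega)
    rw [ellPochs_triple, mul_ne_zero_iff, mul_ne_zero_iff] at this
    rw [ellPoch_neg hq2 h, ellPoch_neg hq2 h, ellPoch_neg hq2 h, neg_sub, ← zpow_natCast q 2,
      ← zpow_mul]
    exact ⟨inv_ne_zero (by simpa using this.1), inv_ne_zero (by simpa using this.2.1),
      inv_ne_zero (by simpa using this.2.2)⟩
  have den : 0 ≤ I - J → ellPoch (q ^ (2 - 2 * I) / (x * y)) q p (I - J) ≠ 0 ∧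
      ellPoch (y * q ^ (1 - 2 * I) / x) q p (I - J) ≠ 0 ∧
      ellPoch (q ^ (I + 1)) q p (I - J) ≠ 0 := by
    intro h
    have := hM.1 I J (by omega) (by omega) (by omega)
    rwa [ellPochs_triple, mul_ne_zero_iff, mul_ne_zero_iff] at this
  -- The denominators are inverted one by one, so that for I < J each inverse is such a finite
  -- product.
  suffices h : ContinuousAt (fun z : ℂ × ℂ × ℂ =>
      ellPoch (z.2.2 * z.1 ^ (1 - I) / z.2.1) (z.1 ^ 2) p (I - J) *
      (ellPoch (z.1 ^ (2 - I) / (z.2.1 * z.2.2)) (z.1 ^ 2) p (I - J) *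
      ellPoch (z.1 ^ (2 - 4 * I) / z.2.1 ^ 2) (z.1 ^ 2) p (I - J)) *
      ((ellPoch (z.1 ^ (2 - 2 * I) / (z.2.1 * z.2.2)) z.1 p (I - J))⁻¹ *
      ((ellPoch (z.2.2 * z.1 ^ (1 - 2 * I) / z.2.1) z.1 p (I - J))⁻¹ *
      (ellPoch (z.1 ^ (I + 1)) z.1 p (I - J))⁻¹))) (q, x, y) by
    refine h.congr (Eventually.of_forall fun z => ?_)
    simp only [entry, ellPochs_triple, div_eq_mul_inv (ellPoch _ _ _ _ * _), mul_inv (ellPoch ..)]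
  have cq2 := cq.pow 2
  have n1 : y * q ^ (1 - I) / x ≠ 0 := div_ne_zero (mul_ne_zero hy (zpow_ne_zero _ hq)) hx
  have n2 : y * q ^ (1 - 2 * I) / x ≠ 0 := div_ne_zero (mul_ne_zero hy (zpow_ne_zero _ hq)) hx
  have n3 (k : ℤ) : q ^ k / (x * y) ≠ 0 := div_ne_zero (zpow_ne_zero _ hq) hxy
  have n4 : q ^ (2 - 4 * I) / x ^ 2 ≠ 0 := div_ne_zero (zpow_ne_zero _ hq) hx2
  have c1 := (cy.mul (cz (1 - I))).div cx hx
  have c2 := (cy.mul (cz (1 - 2 * I))).div cx hx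
  have c3 (k : ℤ) := (cz k).div (cx.mul cy) hxy
  have c4 := (cz (2 - 4 * I)).div (cx.pow 2) hx2
  exact ((continuousAt_ellPoch hp c1 cq2 n1 hq2 fun h => (num h).1).mul
    ((continuousAt_ellPoch hp (c3 _) cq2 (n3 _) hq2 fun h => (num h).2.1).mul
    (continuousAt_ellPoch hp c4 cq2 n4 hq2 fun h => (num h).2.2))).mul
    ((continuousAt_ellPoch_inv hp (c3 _) cq (n3 _) hq fun h => (den h).1).mul
    ((continuousAt_ellPoch_inv hp c2 cq n2 hq fun h => (den h).2.1).mul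
    (continuousAt_ellPoch_inv hp (cz (I + 1)) cq (zpow_ne_zero _ hq) hq fun h => (den h).2.2)))

/-- A factor of the product side, as a function of `q`, `x`, `y`. -/
noncomputable def rhsFactor (p q x y : ℂ) (i : ℤ) : ℂ :=
  ellPochs [q, x ^ 2 * q ^ (2 * i - 2)] q p i / ellPochs [q, x ^ 2 * q ^ (2 * i - 2)] (q ^ 2) p i *
    (ellPochs [x * y * q ^ (i - 1), x * q ^ i / y] (q ^ 2) p i /
      ellPochs [x * y * q ^ (i - 1), x * q ^ i / y] q p i)

lemma rhsFactor_succ (n : ℕ) : rhsFactor p q x y ((n : ℤ) + 1) =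
    detFactor (fun z => E z p) q (x * y * q ^ n) (x * q ^ (n + 1) / y) (x ^ 2 * q ^ (2 * n))
      (n + 1) := by
  have h1 : 2 * ((n : ℤ) + 1) - 2 = (2 * n : ℕ) := by push_cast; ring
  have h2 : (n : ℤ) + 1 - 1 = n := by ring
  have h3 : (n : ℤ) + 1 = (n + 1 : ℕ) := by push_cast; ring
  rw [rhsFactor, h1, h2, h3]
  simp only [ellPochs_pair, zpow_natCast, ellPoch_natCast, detFactor]

lemma prod_Icc_one_int (f : ℤ → ℂ) (n : ℕ) :
    ∏ i ∈ Finset.Icc (1 : ℤ) n, f i = ∏ i : Fin n, f ((i : ℕ) + 1) := by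
  rw [Fin.prod_univ_eq_prod_range (fun k => f ((k : ℤ) + 1))]
  refine (Finset.prod_nbij (fun k : ℕ => (k : ℤ) + 1) ?_ ?_ ?_ fun _ _ => rfl).symm
  · intro k hk
    simp only [Finset.mem_range, Finset.mem_Icc] at hk ⊢
    omega
  · intro k _ l _ h
    simpa using h
  · intro k hk
    simp only [Finset.coe_Icc, Set.mem_Icc, Set.mem_image, Finset.coe_range, Set.mem_Iio] at hk ⊢
    exact ⟨(k - 1).toNat, by omega, by omega⟩

lemma ProductDefined.continuousAt_rhsFactor (hp : ‖p‖ < 1) (hq : q ≠ 0) (hx : x ≠ 0) (hy : y ≠ 0)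
    (hR : ProductDefined n x y q p) {i : ℤ} (hi : i ∈ Finset.Icc (1 : ℤ) n) :
    ContinuousAt (fun z : ℂ × ℂ × ℂ => rhsFactor p z.1 z.2.1 z.2.2 i) (q, x, y) := by
  rw [Finset.mem_Icc] at hi
  obtain ⟨h1, h2⟩ := hR i hi.1 hi.2
  have hpos {z : ℂ} (h : i < 0) : z ≠ 0 := absurd h (by omega)
  have cq : ContinuousAt (fun z : ℂ × ℂ × ℂ => z.1) (q, x, y) := continuousAt_fst
  have cx : ContinuousAt (fun z : ℂ × ℂ × ℂ => z.2.1) (q, x, y) := by fun_prop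
  have cy : ContinuousAt (fun z : ℂ × ℂ × ℂ => z.2.2) (q, x, y) := by fun_prop
  have cz (k : ℤ) : ContinuousAt (fun z : ℂ × ℂ × ℂ => z.1 ^ k) (q, x, y) :=
    cq.zpow₀ k (Or.inl hq)
  have hq2 : q ^ 2 ≠ 0 := pow_ne_zero 2 hq
  have c1 := (cx.pow 2).mul (cz (2 * i - 2))
  have c2 := (cx.mul cy).mul (cz (i - 1))
  have c3 := (cx.mul (cz i)).div cy hy
  have n1 : x ^ 2 * q ^ (2 * i - 2) ≠ 0 := mul_ne_zero (pow_ne_zero 2 hx) (zpow_ne_zero _ hq)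
  have n2 : x * y * q ^ (i - 1) ≠ 0 := mul_ne_zero (mul_ne_zero hx hy) (zpow_ne_zero _ hq)
  have n3 : x * q ^ i / y ≠ 0 := div_ne_zero (mul_ne_zero hx (zpow_ne_zero _ hq)) hy
  simp only [rhsFactor, ellPochs_pair] at h1 h2 ⊢
  exact (((continuousAt_ellPoch hp cq cq hq hq hpos).mul
    (continuousAt_ellPoch hp c1 cq n1 hq hpos)).div
    ((continuousAt_ellPoch hp cq (cq.pow 2) hq hq2 hpos).mul
    (continuousAt_ellPoch hp c1 (cq.pow 2) n1 hq2 hpos)) h1).mul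
    (((continuousAt_ellPoch hp c2 (cq.pow 2) n2 hq2 hpos).mul
    (continuousAt_ellPoch hp c3 (cq.pow 2) n3 hq2 hpos)).div
    ((continuousAt_ellPoch hp c2 cq n2 hq hpos).mul
    (continuousAt_ellPoch hp c3 cq n3 hq hpos)) h2)

/-- With p fixed, both sides are continuous at (q, x, y) and agree on the dense set of generic
points, so their limits along that set coincide. -/
theorem det_entry_eq_prod (hp : ‖p‖ < 1) (hq : q ≠ 0) (hx : x ≠ 0) (hy : y ≠ 0)
    (hM : EntriesDefined n x y q p) (hR : ProductDefined n x y q p) :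
    (Matrix.of fun i j : Fin n => entry x y q p ((i : ℕ) + 1 : ℤ) ((j : ℕ) + 1 : ℤ)).det =
      ∏ i ∈ Finset.Icc (1 : ℤ) n, rhsFactor p q x y i := by
  set M : ℂ × ℂ × ℂ → Matrix (Fin n) (Fin n) ℂ := fun z => Matrix.of fun i j =>
    entry z.2.1 z.2.2 z.1 p ((i : ℕ) + 1 : ℤ) ((j : ℕ) + 1 : ℤ)
  have hl : ContinuousAt (fun z => (M z).det) (q, x, y) := by
    have : ContinuousAt M (q, x, y) := continuousAt_pi.2 fun i => continuousAt_pi.2 fun j =>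
      hM.continuousAt_entry hp hq hx hy i j
    exact (continuous_id.matrix_det (A := id)).continuousAt.comp this
  have hr : ContinuousAt (fun z : ℂ × ℂ × ℂ =>
      ∏ i ∈ Finset.Icc (1 : ℤ) n, rhsFactor p z.1 z.2.1 z.2.2 i) (q, x, y) :=
    tendsto_finsetProd _ fun i hi => (hR.continuousAt_rhsFactor hp hq hx hy hi).tendsto
  have : (𝓝[{z : ℂ × ℂ × ℂ | Generic p z.1 z.2.1 z.2.2}] (q, x, y)).NeBot :=
    mem_closure_iff_nhdsWithin_neBot.1 (dense_generic hp (q, x, y))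
  refine tendsto_nhds_unique_of_eventuallyEq
    (l := 𝓝[{z : ℂ × ℂ × ℂ | Generic p z.1 z.2.1 z.2.2}] (q, x, y)) (hl.tendsto.mono_left nhdsWithin_le_nhds)
    (hr.tendsto.mono_left nhdsWithin_le_nhds) (eventually_nhdsWithin_of_forall fun z hz => ?_)
  beta_reduce
  rw [prod_Icc_one_int]
  simp only [rhsFactor_succ]
  exact Generic.det_eq hp hz n

end Limit

end EllipticDet

theorem mainTheorem8 (n : ℕ) (hn : 0 < n) (p q x y : ℂ) (hp : ‖p‖ < 1)
    (hq : q ≠ 0) (hx : x ≠ 0) (hy : y ≠ 0)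
    (hM : EllipticDet.EntriesDefined n x y q p)
    (hR : EllipticDet.ProductDefined n x y q p) :
    (Matrix.of fun i j : Fin n =>
        EllipticDet.entry x y q p ((i : ℕ) + 1 : ℤ) ((j : ℕ) + 1 : ℤ)).det =
      ∏ i ∈ Finset.Icc (1 : ℤ) n,
        EllipticDet.ellPochs [q, x ^ 2 * q ^ (2 * i - 2)] q p i /
            EllipticDet.ellPochs [q, x ^ 2 * q ^ (2 * i - 2)] (q ^ 2) p i *
          (EllipticDet.ellPochs [x * y * q ^ (i - 1), x * q ^ i / y] (q ^ 2) p i /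
            EllipticDet.ellPochs [x * y * q ^ (i - 1), x * q ^ i / y] q p i) := by
  exact EllipticDet.det_entry_eq_prod hp hq hx hy hM hR
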